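/- Let $p\ge 1$, $A^0\in\mathbb R^{p\times p}$, $r\in\{1,\dots,p\}$, $\eta>0$, $\delta>0$, and let $\sigma_{\max}(\cdot)$ denote the maximum singular value. Assume that $D\equiv\big(1-\sigma_{\max}(I+\eta A^0)\big)/\eta>0$, and let $Q^0\in\mathbb R^{p\times p}$ be the (then unique) solution of $A^0Q^0+Q^0(A^0)^*+\eta A^0Q^0(A^0)^*+I=0$. Consider the process $$x(t)=x(t-1)+\eta A^0x(t-1)+w(t),\qquad t\ge 1,$$ where $w(1),w(2),\dots$ are i.i.d. Gaussian vectors with law $\mathsf N(0,\eta I)$, and $x(0)$ is independent of $\{w(t)\}_{t\ge1}$ and is distributed according to the stationary law $\mathsf N(0,Q^0)$. Let $S^0$ be the support of the $r$-th row $A^0_r$, assume $|S^0|\le k$ with $k$ an integer, and let $A_{\min}$ be the smallest absolute value of the nonzero entries of $A^0_r$. Assume that $C_{\min}\equiv\lambda_{\min}(Q^0_{S^0,S^0})>0$ and that $\alpha>0$, where $\alpha$ is defined by $|\!|\!|Q^0_{(S^0)^C,S^0}(Q^0_{S^0,S^0})^{-1}|\!|\!|_\infty=1-\alpha$ and $|\!|\!|\cdot|\!|\!|_\infty$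 is the operator norm with respect to the sup norms. If $n\in\mathbb N$ satisfies $$n\eta>\frac{10^4k^2\,(kD^{-2}+A_{\min}^{-2})}{\alpha^2DC_{\min}^2}\,\log\Big(\frac{4pk}{\delta}\Big),$$ then, with $\lambda=\sqrt{36\log(4p/\delta)/(D\alpha^2n\eta)}$, with probability larger than $1-\delta$ the $\ell_1$-regularized least squares problem $$\underset{a\in\mathbb R^p}{\text{minimize}}\quad \frac{1}{2\eta^2n}\sum_{t=0}^{n-1}\big\{x_r(t+1)-x_r(t)-\eta\,a^*x(t)\big\}^2+\lambda\|a\|_1$$ recovers the signed support of $A^0_r$: it has a solution, and every solution $\hat a$ satisfies $\mathrm{sign}(\hat a)=\mathrm{sign}(A^0_r)$, where $\mathrm{sign}(0)=0$. -/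

import Mathlib

open MeasureTheory ProbabilityTheory

noncomputable section

namespace NetLearn

/-- The maximum singular value of a square real matrix (Mathlib lists the singular values of a
linear map in decreasing order, starting from index `0`). -/
def sigmaMax {p : ℕ} (M : Matrix (Fin p) (Fin p) ℝ) : ℝ :=
  (Matrix.toEuclideanLin M).singularValues 0

/-- The minimum eigenvalue of a symmetric real matrix on a nonempty finite index type: the least
element of its (real, finite, nonempty) spectrum. -/
def lambdaMin {ι : Type*} [Fintype ι] [DecidableEq ι] (M : Matrix ι ι ℝ) : ℝ :=
  sInf (spectrum ℝ M)

section SupNorm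

attribute [local instance] Matrix.linftyOpNormedAddCommGroup

/-- The operator norm of a real matrix with respect to the sup norms, i.e. the maximum over the
rows of the sum of the absolute values of the entries. -/
def supOpNorm {ι κ : Type*} [Fintype ι] [Fintype κ] (M : Matrix ι κ ℝ) : ℝ := ‖M‖

end SupNorm

/-- The submatrix `M_{L,R}` with rows in `L` and columns in `R`. -/
def block {p : ℕ} (M : Matrix (Fin p) (Fin p) ℝ) (L R : Finset (Fin p)) :
    Matrix L R ℝ :=
  M.submatrix (fun i => (i : Fin p)) (fun j => (j : Fin p))

/-- The support of row `r` of `A`. -/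
def rowSupport {p : ℕ} (A : Matrix (Fin p) (Fin p) ℝ) (r : Fin p) : Finset (Fin p) :=
  Finset.univ.filter (fun j => A r j ≠ 0)

/-- The smallest absolute value among the nonzero entries of row `r` of `A`. -/
def Amin {p : ℕ} (A : Matrix (Fin p) (Fin p) ℝ) (r : Fin p) : ℝ :=
  ⨅ j : rowSupport A r, |A r j|

/-- The gap `D = (1 - σ_max(I + η A)) / η`. -/
def gap {p : ℕ} (η : ℝ) (A : Matrix (Fin p) (Fin p) ℝ) : ℝ :=
  (1 - sigmaMax (1 + η • A)) / η

/-- `C_min`, the minimum eigenvalue of `Q_{S,S}`, where `S` is the support of row `r` of `A`. -/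
def Cmin {p : ℕ} (A Q : Matrix (Fin p) (Fin p) ℝ) (r : Fin p) : ℝ :=
  lambdaMin (block Q (rowSupport A r) (rowSupport A r))

/-- The incoherence parameter `α`, given by `|||Q_{Sᶜ,S} (Q_{S,S})⁻¹|||_∞ = 1 - α`, where `S` is
the support of row `r` of `A`. -/
def incoherence {p : ℕ} (A Q : Matrix (Fin p) (Fin p) ℝ) (r : Fin p) : ℝ :=
  1 - supOpNorm (block Q (rowSupport A r)ᶜ (rowSupport A r) *
    (block Q (rowSupport A r) (rowSupport A r))⁻¹)

/-- The modified Lyapunov equation `A Q + Q Aᵀ + η A Q Aᵀ + I = 0` that determines the covariance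
`Q` of the stationary distribution. It is equivalent to `Q = (I + ηA) Q (I + ηA)ᵀ + η I`, so for
`σ_max(I + η A) < 1` it has exactly one solution. -/
def IsStationaryCov {p : ℕ} (η : ℝ) (A Q : Matrix (Fin p) (Fin p) ℝ) : Prop :=
  A * Q + Q * A.transpose + η • (A * Q * A.transpose) + 1 = 0

/-- The discrete-time model `x(t) = x(t-1) + η A x(t-1) + w(t)`, `t ≥ 1`, on a probability space
`(Ω, P)`: the noise vectors `w(1), w(2), …` are i.i.d. `N(0, η I)`, and the initial state `x(0)` is
independent of the noise and has the stationary law `N(0, Q)`. (`w 0` is not used.) -/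
structure IsStationaryModel {p : ℕ} (η : ℝ) (A Q : Matrix (Fin p) (Fin p) ℝ)
    {Ω : Type*} [MeasurableSpace Ω] (P : Measure Ω)
    (x w : ℕ → Ω → EuclideanSpace ℝ (Fin p)) : Prop where
  cov : IsStationaryCov η A Q
  init_law : HasLaw (x 0) (multivariateGaussian 0 Q) P
  noise_law : ∀ t, HasLaw (w (t + 1)) (multivariateGaussian 0 (η • 1)) P
  noise_indep : iIndepFun (fun t => w (t + 1)) P
  init_indep : IndepFun (x 0) (fun ω t => w (t + 1) ω) P
  step : ∀ t ω, x (t + 1) ω = x t ω + η • Matrix.toEuclideanLin A (x t ω) + w (t + 1) ω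

/-- The least squares cost
`L(a; x_0^n) = (1 / (2 η² n)) ∑_{t < n} (x_r(t+1) - x_r(t) - η ⟨a, x(t)⟩)²`. -/
def lossL {p : ℕ} (η : ℝ) (n : ℕ) (r : Fin p) (y : ℕ → EuclideanSpace ℝ (Fin p))
    (a : Fin p → ℝ) : ℝ :=
  1 / (2 * η ^ 2 * n) *
    ∑ t ∈ Finset.range n, (y (t + 1) r - y t r - η * ∑ j, a j * y t j) ^ 2

/-- `a` is a solution of the `ℓ₁`-regularized least squares problem: it minimizes
`L(a; x_0^n) + lam * ‖a‖₁` over `ℝ^p`. -/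
def IsRegLeastSquares {p : ℕ} (η : ℝ) (n : ℕ) (lam : ℝ) (r : Fin p)
    (y : ℕ → EuclideanSpace ℝ (Fin p)) (a : Fin p → ℝ) : Prop :=
  ∀ b : Fin p → ℝ,
    lossL η n r y a + lam * ∑ j, |a j| ≤ lossL η n r y b + lam * ∑ j, |b j|

/-- On the trajectory `y`, `ℓ₁`-regularized least squares recovers the signed support of row `r`
of `A`: the problem has a solution, and every solution has the sign vector of that row. -/
def RecoversSignedSupport {p : ℕ} (η : ℝ) (n : ℕ) (lam : ℝ) (A : Matrix (Fin p) (Fin p) ℝ)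
    (r : Fin p) (y : ℕ → EuclideanSpace ℝ (Fin p)) : Prop :=
  (∃ a, IsRegLeastSquares η n lam r y a) ∧
    ∀ a, IsRegLeastSquares η n lam r y a → ∀ j, SignType.sign (a j) = SignType.sign (A r j)

/-- The regularization parameter `λ = √(36 log(4p/δ) / (D α² n η))`. -/
def regParam {p : ℕ} (η : ℝ) (n : ℕ) (δ : ℝ) (A Q : Matrix (Fin p) (Fin p) ℝ) (r : Fin p) : ℝ :=
  Real.sqrt (36 * Real.log (4 * p / δ) / (gap η A * incoherence A Q r ^ 2 * (n * η)))

end NetLearn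

end

noncomputable section

namespace NetLearn

open scoped RealInnerProductSpace

/-! The proof separates a deterministic recovery statement from two concentration estimates.

Up to a constant, the penalised loss is a lasso objective centred at the true row, with matrix the
empirical covariance M and linear term the noise correlation g. A primal-dual witness
(`lasso_recovery_of_witness`) solves the stationarity equation on the support S, then checks strict
dual feasibility off S. `lasso_recovery` shows that this succeeds when the columns of M in S are
entrywise within e = αC/(12k) of those of Q, every |g j| is at most λα/3, and the nonzero entries of
the row exceed 16kλ/(11C).

For the probability, x(0) and the noise are whitened, so the trajectory becomes a linear image of
one standard Gaussian vector (`IsStationaryModel.exists_representation`). Entries of M and g are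
then quadratic forms in that vector, and `sum_inner_mul_inner_stdGaussian_tail` controls them
through an operator norm bound and a Hilbert-Schmidt bound. Both come from ‖I + ηA‖ ≤ σ < 1: an
energy estimate bounds the sum of ‖x(t)‖² by η/(1-σ)² times the squared norm of the noise, and the
Lyapunov equation gives Q ≤ η/(1-σ) = 1/D. No mixing argument is needed.

A union bound over the p entries of g and at most pk entries of M spends δ/2 on each family. -/

/-! ### Exponential moments and tails of Gaussian quadratic forms. -/

/-- This is -log(1-v) ≤ v + v². Since (1-v)(1+v+v²) = 1 - v³, the linear lower bound on exp suffices
for v ≤ 0, but v ≥ 0 needs the quadratic one. -/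
lemma one_le_one_sub_mul_exp {v : ℝ} (hv : |v| ≤ 1 / 2) :
    1 ≤ (1 - v) * Real.exp (v + v ^ 2) := by
  obtain ⟨h1, h2⟩ := abs_le.1 hv
  rcases le_total 0 v with h | h
  · have h3 := Real.quadratic_le_exp_of_nonneg (x := v + v ^ 2) (by positivity)
    calc (1 : ℝ) ≤ (1 - v) * (1 + (v + v ^ 2) + (v + v ^ 2) ^ 2 / 2) := by
          have : 0 ≤ v ^ 2 * (1 / 2 - v / 2 - v ^ 2 / 2 - v ^ 3 / 2) := by
            have : v ^ 3 ≤ 1 / 8 := by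
              calc v ^ 3 ≤ (1 / 2) ^ 3 := by gcongr
                _ = 1 / 8 := by norm_num
            have : v ^ 2 ≤ 1 / 4 := by nlinarith
            apply mul_nonneg (sq_nonneg v); linarith
          nlinarith
      _ ≤ _ := by gcongr; linarith
  · have h3 := Real.add_one_le_exp (v + v ^ 2)
    calc (1 : ℝ) ≤ (1 - v) * (v + v ^ 2 + 1) := by nlinarith [pow_nonneg (neg_nonneg.2 h) 3]
      _ ≤ _ := by gcongr; linarith

lemma integral_exp_mul_sq_gaussianReal {c : ℝ} (hc : c < 1 / 2) :
    ∫ y, Real.exp (c * y ^ 2) ∂(gaussianReal 0 1) = (√(1 - 2 * c))⁻¹ := by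
  rw [integral_gaussianReal_eq_integral_smul (by norm_num)]
  have : ∀ y : ℝ, gaussianPDFReal 0 1 y • Real.exp (c * y ^ 2) =
      (√(2 * Real.pi))⁻¹ * Real.exp (-(1 / 2 - c) * y ^ 2) := by
    intro y
    rw [gaussianPDFReal_def]
    simp only [NNReal.coe_one, mul_one, sub_zero, smul_eq_mul, mul_assoc]
    rw [← Real.exp_add]
    congr 2; ring
  simp_rw [this]
  rw [integral_const_mul, integral_gaussian, ← Real.sqrt_inv, ← Real.sqrt_inv,
    ← Real.sqrt_mul (by positivity)]
  congr 1
  have : 1 - 2 * c ≠ 0 := by linarith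
  have : 1 / 2 - c ≠ 0 := by linarith
  field_simp

lemma integrable_exp_mul_sq_gaussianReal {c : ℝ} (hc : c < 1 / 2) :
    Integrable (fun y => Real.exp (c * y ^ 2)) (gaussianReal 0 1) := by
  -- A nonintegrable function has Bochner integral 0, so the positive value already computed gives
  -- integrability.
  apply Integrable.of_integral_ne_zero
  rw [integral_exp_mul_sq_gaussianReal hc]
  have : 0 < 1 - 2 * c := by linarith
  positivity

lemma integral_exp_mul_sq_gaussianReal_le {c : ℝ} (hc : |c| ≤ 1 / 4) :
    ∫ y, Real.exp (c * y ^ 2) ∂(gaussianReal 0 1) ≤ Real.exp (c + 2 * c ^ 2) := by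
  have h1 := abs_le.1 hc
  have h2 : 0 < 1 - 2 * c := by linarith
  rw [integral_exp_mul_sq_gaussianReal (by linarith)]
  apply inv_le_of_inv_le₀ (Real.exp_pos _)
  apply Real.le_sqrt_of_sq_le
  rw [← Real.exp_neg, sq, ← Real.exp_add]
  have h3 := one_le_one_sub_mul_exp (v := 2 * c) (by rw [abs_mul]; norm_num; linarith)
  have h4 : Real.exp (-(c + 2 * c ^ 2) + -(c + 2 * c ^ 2)) =
      (Real.exp (2 * c + (2 * c) ^ 2))⁻¹ := by
    rw [← Real.exp_neg]; congr 1; ring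
  rw [h4]
  exact inv_le_of_inv_le₀ h2 (by rw [inv_le_iff_one_le_mul₀ h2]; linarith)

section Chaos

variable {E : Type*} [NormedAddCommGroup E] [InnerProductSpace ℝ E] [FiniteDimensional ℝ E]

lemma inner_self_eq_sum_eigenvalues {T : E →ₗ[ℝ] E} (hT : T.IsSymmetric) (z : E) :
    ⟪T z, z⟫ = ∑ i, hT.eigenvalues rfl i * ⟪hT.eigenvectorBasis rfl i, z⟫ ^ 2 := by
  rw [← (hT.eigenvectorBasis rfl).sum_inner_mul_inner]
  refine Finset.sum_congr rfl fun i _ => ?_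
  rw [hT, hT.apply_eigenvectorBasis, real_inner_comm, inner_smul_left]
  simp only [RCLike.ofReal_real_eq_id, id, conj_trivial, real_inner_comm z]
  ring

variable [MeasurableSpace E] [BorelSpace E]

/-- In an eigenbasis of T the coordinates are independent standard normals, so the integral factors
into scalar chi-square moments. The exponent is θ tr T + 2θ² tr T². -/
lemma exp_quadraticForm_stdGaussian {T : E →ₗ[ℝ] E} (hT : T.IsSymmetric) {θ : ℝ}
    (hθ : ∀ i, |θ * hT.eigenvalues rfl i| ≤ 1 / 4) :
    Integrable (fun z => Real.exp (θ * ⟪T z, z⟫)) (stdGaussian E) ∧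
      ∫ z, Real.exp (θ * ⟪T z, z⟫) ∂(stdGaussian E) ≤
        Real.exp (θ * ∑ i, hT.eigenvalues rfl i +
          2 * θ ^ 2 * ∑ i, hT.eigenvalues rfl i ^ 2) := by
  have hm : Measurable (fun x : Fin (Module.finrank ℝ E) → ℝ =>
      ∑ i, x i • hT.eigenvectorBasis rfl i) := by fun_prop
  have hTc : Continuous T := T.continuous_of_finiteDimensional
  have key : ∀ x : Fin (Module.finrank ℝ E) → ℝ,
      Real.exp (θ * ⟪T (∑ i, x i • hT.eigenvectorBasis rfl i),
        ∑ i, x i • hT.eigenvectorBasis rfl i⟫) =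
      ∏ i, Real.exp (θ * hT.eigenvalues rfl i * x i ^ 2) := by
    intro x
    rw [inner_self_eq_sum_eigenvalues hT, Finset.mul_sum, Real.exp_sum]
    refine Finset.prod_congr rfl fun i _ => ?_
    have : ⟪hT.eigenvectorBasis rfl i, ∑ j, x j • hT.eigenvectorBasis rfl j⟫ = x i := by
      simp [inner_sum, inner_smul_right, (hT.eigenvectorBasis rfl).inner_eq_ite]
    rw [this]; ring_nf
  have hc : ∀ i, θ * hT.eigenvalues rfl i < 1 / 2 := fun i => by
    have := (abs_le.1 (hθ i)).2; linarith
  rw [stdGaussian_eq_map_pi_orthonormalBasis (hT.eigenvectorBasis rfl)]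
  constructor
  · rw [integrable_map_measure (by fun_prop) hm.aemeasurable]
    simp only [Function.comp_def, key]
    exact Integrable.fintype_prod (f := fun i y => Real.exp (θ * hT.eigenvalues rfl i * y ^ 2))
      fun i => integrable_exp_mul_sq_gaussianReal (hc i)
  · rw [integral_map hm.aemeasurable (by fun_prop)]
    simp only [key]
    rw [integral_fintype_prod_eq_prod
      (fun i y => Real.exp (θ * hT.eigenvalues rfl i * y ^ 2))]
    have : θ * ∑ i, hT.eigenvalues rfl i + 2 * θ ^ 2 * ∑ i, hT.eigenvalues rfl i ^ 2 =
        ∑ i, (θ * hT.eigenvalues rfl i + 2 * (θ * hT.eigenvalues rfl i) ^ 2) := by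
      rw [Finset.sum_add_distrib, Finset.mul_sum, Finset.mul_sum]
      congr 1
      exact Finset.sum_congr rfl fun i _ => by ring
    rw [this, Real.exp_sum]
    exact Finset.prod_le_prod (fun i _ => integral_nonneg fun _ => (Real.exp_pos _).le)
      fun i _ => integral_exp_mul_sq_gaussianReal_le (hθ i)

/-- Chernoff's bound at θ = s/(4V), the minimiser of -θs + 2θ²V. The condition `hsΛ` is what keeps
|θλᵢ| ≤ 1/4, and the sign `e` lets one argument serve both tails. -/
lemma quadraticForm_stdGaussian_upper_tail {T : E →ₗ[ℝ] E} (hT : T.IsSymmetric) {Λ V s : ℝ}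
    (hΛ : ∀ i, |hT.eigenvalues rfl i| ≤ Λ) (hV : ∑ i, hT.eigenvalues rfl i ^ 2 ≤ V)
    (hV0 : 0 < V) (hs : 0 ≤ s) (hsΛ : s * Λ ≤ V) (e : ℝ) (he : |e| = 1) :
    (stdGaussian E).real {z | s ≤ e * (⟪T z, z⟫ - ∑ i, hT.eigenvalues rfl i)} ≤
      Real.exp (-s ^ 2 / (8 * V)) := by
  have he2 : e ^ 2 = 1 := by rw [← sq_abs, he, one_pow]
  set θ := s / (4 * V) with hθ
  have hθ0 : 0 ≤ θ := by positivity
  obtain ⟨h1, h2⟩ := exp_quadraticForm_stdGaussian hT (θ := θ * e) (fun i => by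
    rw [abs_mul, abs_mul, he, mul_one, abs_of_nonneg hθ0]
    calc θ * |hT.eigenvalues rfl i| ≤ θ * Λ := by gcongr; exact hΛ i
      _ = s * Λ / (4 * V) := by rw [hθ]; ring
      _ ≤ V / (4 * V) := by gcongr
      _ = 1 / 4 := by field_simp)
  set X : E → ℝ := fun z => e * (⟪T z, z⟫ - ∑ i, hT.eigenvalues rfl i)
  have hX : ∀ z, Real.exp (θ * X z) =
      Real.exp (θ * e * ⟪T z, z⟫) * Real.exp (-(θ * e * ∑ i, hT.eigenvalues rfl i)) := by
    intro z; rw [← Real.exp_add]; congr 1; simp only [X]; ring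
  have hint : Integrable (fun z => Real.exp (θ * X z)) (stdGaussian E) := by
    simp only [hX]; exact h1.mul_const _
  refine (measure_ge_le_exp_mul_mgf s hθ0 hint).trans ?_
  simp only [mgf, hX]
  rw [integral_mul_const]
  calc _ ≤ Real.exp (-θ * s) * (Real.exp (θ * e * ∑ i, hT.eigenvalues rfl i +
          2 * (θ * e) ^ 2 * ∑ i, hT.eigenvalues rfl i ^ 2) *
          Real.exp (-(θ * e * ∑ i, hT.eigenvalues rfl i))) := by gcongr
    _ = Real.exp (-θ * s + 2 * θ ^ 2 * ∑ i, hT.eigenvalues rfl i ^ 2) := by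
        rw [← Real.exp_add, ← Real.exp_add, mul_pow, he2]; congr 1; ring
    _ ≤ Real.exp (-θ * s + 2 * θ ^ 2 * V) := by gcongr
    _ = _ := by congr 1; rw [hθ]; field_simp; ring

lemma quadraticForm_stdGaussian_tail {T : E →ₗ[ℝ] E} (hT : T.IsSymmetric) {Λ V s : ℝ}
    (hΛ : ∀ i, |hT.eigenvalues rfl i| ≤ Λ) (hV : ∑ i, hT.eigenvalues rfl i ^ 2 ≤ V)
    (hV0 : 0 < V) (hs : 0 ≤ s) (hsΛ : s * Λ ≤ V) :
    (stdGaussian E).real {z | s ≤ |⟪T z, z⟫ - ∑ i, hT.eigenvalues rfl i|} ≤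
      2 * Real.exp (-s ^ 2 / (8 * V)) := by
  have h1 := quadraticForm_stdGaussian_upper_tail hT hΛ hV hV0 hs hsΛ 1 (by simp)
  have h2 := quadraticForm_stdGaussian_upper_tail hT hΛ hV hV0 hs hsΛ (-1) (by simp)
  have : {z | s ≤ |⟪T z, z⟫ - ∑ i, hT.eigenvalues rfl i|} =
      {z | s ≤ 1 * (⟪T z, z⟫ - ∑ i, hT.eigenvalues rfl i)} ∪
      {z | s ≤ -1 * (⟪T z, z⟫ - ∑ i, hT.eigenvalues rfl i)} := by
    ext z; simp only [Set.mem_ofPred_eq, le_abs, Set.mem_union, one_mul, neg_one_mul]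
  rw [this]
  refine (measureReal_union_le _ _).trans ?_
  linarith

/-- Concentration of a sum of products of linear functionals of a standard Gaussian vector. -/
theorem sum_inner_mul_inner_stdGaussian_tail {τ : Type*} (F : Finset τ) (a b : τ → E)
    {Λ V s : ℝ} (hΛ : ∀ h, |∑ t ∈ F, ⟪a t, h⟫ * ⟪b t, h⟫| ≤ Λ * ‖h‖ ^ 2)
    (hV : ∑ t ∈ F, ∑ u ∈ F, (⟪a t, a u⟫ * ⟪b t, b u⟫ + ⟪a t, b u⟫ * ⟪b t, a u⟫) ≤ 2 * V)
    (hV0 : 0 < V) (hs : 0 ≤ s) (hsΛ : s * Λ ≤ V) :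
    (stdGaussian E).real {z | s ≤ |∑ t ∈ F, ⟪a t, z⟫ * ⟪b t, z⟫ - ∑ t ∈ F, ⟪a t, b t⟫|} ≤
      2 * Real.exp (-s ^ 2 / (8 * V)) := by
  classical
  -- The symmetrisation of the sum of the rank-one maps a t ⊗ b t: same quadratic form, but
  -- diagonalisable. By Parseval its trace is ∑ ⟪a t, b t⟫ and tr T² is half the double sum in `hV`.
  let T : E →ₗ[ℝ] E := (1 / 2 : ℝ) • ∑ t ∈ F,
    ((innerₛₗ ℝ (b t)).smulRight (a t) + (innerₛₗ ℝ (a t)).smulRight (b t))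
  have hTa : ∀ h, T h = (1 / 2 : ℝ) • ∑ t ∈ F, (⟪b t, h⟫ • a t + ⟪a t, h⟫ • b t) := by
    intro h; simp [T, LinearMap.sum_apply]
  have hTi : ∀ h k, ⟪T h, k⟫ = 1 / 2 * ∑ t ∈ F, (⟪b t, h⟫ * ⟪a t, k⟫ + ⟪a t, h⟫ * ⟪b t, k⟫) := by
    intro h k
    rw [hTa, real_inner_smul_left, sum_inner]
    simp only [inner_add_left, real_inner_smul_left]
  have hT : T.IsSymmetric := by
    intro h k
    rw [hTi, real_inner_comm, hTi]
    congr 1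
    exact Finset.sum_congr rfl fun t _ => by ring
  have hTz : ∀ z, ⟪T z, z⟫ = ∑ t ∈ F, ⟪a t, z⟫ * ⟪b t, z⟫ := by
    intro z
    rw [hTi, Finset.mul_sum]
    exact Finset.sum_congr rfl fun t _ => by ring
  set e := hT.eigenvectorBasis rfl
  have hev : ∀ i, hT.eigenvalues rfl i = ⟪T (e i), e i⟫ := by
    intro i
    rw [hT.apply_eigenvectorBasis, inner_smul_left]
    simp [e]
  have hnorm : ∀ i, ‖e i‖ = 1 := fun i => e.orthonormal.1 i
  have hpars : ∀ u v : E, ∑ i, ⟪u, e i⟫ * ⟪v, e i⟫ = ⟪u, v⟫ := by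
    intro u v
    rw [← e.sum_inner_mul_inner u v]
    exact Finset.sum_congr rfl fun i _ => by rw [real_inner_comm v]
  have htr : ∑ i, hT.eigenvalues rfl i = ∑ t ∈ F, ⟪a t, b t⟫ := by
    simp only [hev, hTz]
    rw [Finset.sum_comm]
    exact Finset.sum_congr rfl fun t _ => hpars _ _
  have hHS : ∑ i, hT.eigenvalues rfl i ^ 2 ≤ V := by
    have : ∀ i, hT.eigenvalues rfl i ^ 2 = ⟪T (e i), T (e i)⟫ := by
      intro i
      rw [hT.apply_eigenvectorBasis, inner_smul_left, inner_smul_right,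
        real_inner_self_eq_norm_sq]
      simp only [hnorm, e]; simp; ring
    have h2 : ∀ i, ⟪T (e i), T (e i)⟫ = 1 / 2 * ∑ t ∈ F,
        (⟪b t, e i⟫ * ⟪T (a t), e i⟫ + ⟪a t, e i⟫ * ⟪T (b t), e i⟫) := by
      intro i
      rw [hTi]
      simp only [hT _ (e i)]
    simp only [this, h2]
    rw [← Finset.mul_sum, Finset.sum_comm]
    simp only [Finset.sum_add_distrib, hpars]
    have h3 : ∀ t, ⟪b t, T (a t)⟫ =
        1 / 2 * ∑ u ∈ F, (⟪a t, a u⟫ * ⟪b t, b u⟫ + ⟪a t, b u⟫ * ⟪b t, a u⟫) := by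
      intro t
      rw [real_inner_comm, hTi]
      congr 1
      refine Finset.sum_congr rfl fun u _ => ?_
      rw [real_inner_comm (b t), real_inner_comm (b t), real_inner_comm (a t),
        real_inner_comm (a t)]
      ring
    have h4 : ∀ t, ⟪a t, T (b t)⟫ =
        1 / 2 * ∑ u ∈ F, (⟪a t, a u⟫ * ⟪b t, b u⟫ + ⟪a t, b u⟫ * ⟪b t, a u⟫) := by
      intro t
      rw [← h3, ← hT, real_inner_comm]
    simp only [h3, h4, ← Finset.mul_sum]
    linarith
  have := quadraticForm_stdGaussian_tail hT (fun i => by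
    rw [hev, hTz]; simpa [hnorm] using hΛ (e i)) hHS hV0 hs hsΛ
  simpa only [htr, hTz] using this

end Chaos

/-! ### Deterministic sign recovery for the lasso. -/

section Lasso

open Matrix

variable {ι : Type*} [Fintype ι]

/-- The `ℓ₁`-penalised quadratic objective, centred at `a₀`. -/
def lassoObj (M : Matrix ι ι ℝ) (g a₀ : ι → ℝ) (lam : ℝ) (b : ι → ℝ) : ℝ :=
  1 / 2 * ((b - a₀) ⬝ᵥ M *ᵥ (b - a₀)) - g ⬝ᵥ (b - a₀) + lam * ∑ j, |b j|

lemma dotProduct_mulVec_comm_of_transpose {M : Matrix ι ι ℝ} (hM : Mᵀ = M) (u v : ι → ℝ) :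
    u ⬝ᵥ M *ᵥ v = v ⬝ᵥ M *ᵥ u := by
  rw [dotProduct_mulVec, ← mulVec_transpose, hM, dotProduct_comm]

/-- Expansion of the objective around a point whose residual is `lam • z`. -/
lemma lassoObj_sub {M : Matrix ι ι ℝ} (hM : Mᵀ = M) (g a₀ a b : ι → ℝ) (lam : ℝ) (z : ι → ℝ)
    (hz : ∀ j, g j - (M *ᵥ (a - a₀)) j = lam * z j) :
    lassoObj M g a₀ lam b - lassoObj M g a₀ lam a =
      1 / 2 * ((b - a) ⬝ᵥ M *ᵥ (b - a)) + lam * ∑ j, (|b j| - |a j| - z j * (b j - a j)) := by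
  have hg : g = M *ᵥ (a - a₀) + lam • z := by
    ext j; simp [← hz]
  have hb : b - a₀ = (b - a) + (a - a₀) := by abel
  have hs : ∑ j, (|b j| - |a j| - z j * (b j - a j)) =
      ∑ j, |b j| - ∑ j, |a j| - z ⬝ᵥ (b - a) := by
    simp [Finset.sum_sub_distrib, dotProduct]
  rw [hs]
  simp only [lassoObj]
  rw [hb, hg]
  simp only [mulVec_add, dotProduct_add, add_dotProduct, smul_dotProduct, smul_eq_mul]
  rw [dotProduct_mulVec_comm_of_transpose hM (a - a₀) (b - a),
    dotProduct_comm (M *ᵥ (a - a₀)) (b - a)]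
  ring

/-- The primal-dual witness construction. -/
theorem lasso_recovery_of_witness {M : Matrix ι ι ℝ} (hM : Mᵀ = M) (hpsd : ∀ v, 0 ≤ v ⬝ᵥ M *ᵥ v)
    {g a₀ Δ : ι → ℝ} {lam : ℝ} (hlam : 0 < lam)
    (hpd : ∀ v : ι → ℝ, (∀ j, a₀ j = 0 → v j = 0) → v ⬝ᵥ M *ᵥ v = 0 → v = 0)
    (hΔ0 : ∀ j, a₀ j = 0 → Δ j = 0) (hΔ : ∀ j, a₀ j ≠ 0 → |Δ j| < |a₀ j|)
    (hon : ∀ j, a₀ j ≠ 0 → g j - (M *ᵥ Δ) j = lam * (SignType.sign (a₀ j) : ℝ))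
    (hoff : ∀ j, a₀ j = 0 → |g j - (M *ᵥ Δ) j| < lam) :
    (∃ a, ∀ b, lassoObj M g a₀ lam a ≤ lassoObj M g a₀ lam b) ∧
      ∀ a, (∀ b, lassoObj M g a₀ lam a ≤ lassoObj M g a₀ lam b) →
        ∀ j, SignType.sign (a j) = SignType.sign (a₀ j) := by
  set a := a₀ + Δ with ha
  -- The dual certificate: a subgradient of the ℓ₁ norm at `a`, with modulus below 1 off the
  -- support.
  set z : ι → ℝ := fun j => (g j - (M *ᵥ Δ) j) / lam with hz
  have haΔ : a - a₀ = Δ := by simp [ha]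
  have hexp := fun b => lassoObj_sub hM g a₀ a b lam z (fun j => by
    rw [haΔ, hz]; field_simp)
  have hsign : ∀ j, SignType.sign (a j) = SignType.sign (a₀ j) := by
    intro j
    by_cases h : a₀ j = 0
    · simp [ha, h, hΔ0 j h]
    · have h1 := abs_lt.1 (hΔ j h)
      rcases lt_or_gt_of_ne h with h2 | h2
      · rw [abs_of_neg h2] at h1
        rw [sign_neg h2, sign_neg (show a j < 0 by simp only [ha, Pi.add_apply]; linarith)]
      · rw [abs_of_pos h2] at h1
        rw [sign_pos h2, sign_pos (show 0 < a j by simp only [ha, Pi.add_apply]; linarith)]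
  have hzon : ∀ j, a₀ j ≠ 0 → z j = SignType.sign (a₀ j) := by
    intro j h; simp only [hz, hon j h]; field_simp
  have hzoff : ∀ j, a₀ j = 0 → |z j| < 1 := by
    intro j h
    simp only [hz, abs_div, abs_of_pos hlam]
    rw [div_lt_one hlam]; exact hoff j h
  have haoff : ∀ j, a₀ j = 0 → a j = 0 := by
    intro j h; simp [ha, h, hΔ0 j h]
  have hterm : ∀ b : ι → ℝ, ∀ j, 0 ≤ |b j| - |a j| - z j * (b j - a j) := by
    intro b j
    by_cases h : a₀ j = 0
    · rw [haoff j h, abs_zero, sub_zero, sub_zero, sub_nonneg]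
      calc z j * b j ≤ |z j * b j| := le_abs_self _
        _ = |z j| * |b j| := abs_mul _ _
        _ ≤ 1 * |b j| := by gcongr; exact (hzoff j h).le
        _ = |b j| := one_mul _
    · rw [hzon j h, ← hsign j]
      have h1 : (SignType.sign (a j) : ℝ) * a j = |a j| := by rw [mul_comm, self_mul_sign]
      have h2 : (SignType.sign (a j) : ℝ) * b j ≤ |b j| := by
        rcases lt_trichotomy (a j) 0 with h3 | h3 | h3
        · rw [sign_neg h3]; simpa using neg_le_abs (b j)
        · rw [h3]; simp
        · rw [sign_pos h3]; simpa using le_abs_self (b j)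
      linarith
  have hmin : ∀ b, lassoObj M g a₀ lam a ≤ lassoObj M g a₀ lam b := by
    intro b
    have h1 := hexp b
    have h2 : 0 ≤ lam * ∑ j, (|b j| - |a j| - z j * (b j - a j)) :=
      mul_nonneg hlam.le (Finset.sum_nonneg fun j _ => hterm b j)
    have := hpsd (b - a)
    linarith
  refine ⟨⟨a, hmin⟩, fun b hb => ?_⟩
  have h1 := hexp b
  have h2 : 0 ≤ ∑ j, (|b j| - |a j| - z j * (b j - a j)) :=
    Finset.sum_nonneg fun j _ => hterm b j
  have h3 := hpsd (b - a)
  have h4 := hb a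
  have h2' := mul_nonneg hlam.le h2
  -- For a second minimiser both nonnegative terms of the expansion vanish. Strict dual feasibility
  -- then forces `b` to be 0 off the support, and definiteness there forces `b = a`.
  have h5 : ∑ j, (|b j| - |a j| - z j * (b j - a j)) = 0 := by
    have : lam * ∑ j, (|b j| - |a j| - z j * (b j - a j)) = 0 := by linarith
    exact (mul_eq_zero.1 this).resolve_left hlam.ne'
  have h6 : (b - a) ⬝ᵥ M *ᵥ (b - a) = 0 := by linarith
  have hboff : ∀ j, a₀ j = 0 → b j = 0 := by
    intro j h
    have h7 := (Finset.sum_eq_zero_iff_of_nonneg fun j _ => hterm b j).1 h5 j (Finset.mem_univ j)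
    rw [haoff j h, abs_zero, sub_zero, sub_zero] at h7
    by_contra h8
    have h9 : 0 < |b j| := abs_pos.2 h8
    have : z j * b j ≤ |z j| * |b j| := by rw [← abs_mul]; exact le_abs_self _
    nlinarith [hzoff j h]
  have hba : b = a := by
    have := hpd (b - a) (fun j h => by simp [hboff j h, haoff j h]) h6
    exact sub_eq_zero.1 this
  rw [hba]
  exact hsign

lemma abs_sum_mul_le_of_forall_le {κ : Type*} [Fintype κ] {u v : κ → ℝ} {c : ℝ}
    (h : ∀ i, |v i| ≤ c) : |∑ i, u i * v i| ≤ (∑ i, |u i|) * c := by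
  rw [Finset.sum_mul]
  refine (Finset.abs_sum_le_sum_abs _ _).trans (Finset.sum_le_sum fun i _ => ?_)
  rw [abs_mul]
  gcongr
  exact h i

set_option maxHeartbeats 1000000 in
/-- Signed support recovery when the empirical matrix `M` is entrywise close to `Q` on the columns
in the support. -/
theorem lasso_recovery [DecidableEq ι] {M Q : Matrix ι ι ℝ} (hM : Mᵀ = M) (hpsd : ∀ v, 0 ≤ v ⬝ᵥ M *ᵥ v)
    {g a₀ : ι → ℝ} (S : Finset ι) (hS : ∀ j, j ∈ S ↔ a₀ j ≠ 0) {lam C α e k : ℝ}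
    (hlam : 0 < lam) (hC : 0 < C) (hα : 0 < α) (hα1 : α ≤ 1) (hk : (S.card : ℝ) ≤ k)
    (he : 0 ≤ e) (hek : e * k ≤ α * C / 12)
    (hQ : ∀ v : S → ℝ, C * ∑ i, v i ^ 2 ≤ ∑ i, v i * ∑ j : S, Q i j * v j)
    (hinc : ∀ i, i ∉ S → ∃ u : S → ℝ, ∑ l, |u l| ≤ 1 - α ∧ ∀ j : S, Q i j = ∑ l, u l * Q l j)
    (hclose : ∀ i, ∀ j ∈ S, |M i j - Q i j| ≤ e)
    (hg : ∀ j, |g j| ≤ lam * α / 3)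
    (hmin : ∀ j ∈ S, 16 * k * lam / (11 * C) < |a₀ j|) :
    (∃ a, ∀ b, lassoObj M g a₀ lam a ≤ lassoObj M g a₀ lam b) ∧
      ∀ a, (∀ b, lassoObj M g a₀ lam a ≤ lassoObj M g a₀ lam b) →
        ∀ j, SignType.sign (a j) = SignType.sign (a₀ j) := by
  have hl1 : ∀ v : S → ℝ, (∑ i, |v i|) ^ 2 ≤ k * ∑ i, v i ^ 2 := by
    intro v
    have := sq_sum_le_card_mul_sum_sq (s := Finset.univ) (f := fun i => |v i|)
    simp only [Finset.card_univ, Fintype.card_coe, sq_abs] at this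
    exact this.trans (by gcongr)
  have hEv : ∀ v : S → ℝ, ∀ i : ι, |∑ j : S, (M i j - Q i j) * v j| ≤ e * ∑ j, |v j| := by
    intro v i
    have := abs_sum_mul_le_of_forall_le (u := v) (v := fun j : S => M i j - Q i j)
      (fun j => hclose i j j.2)
    simp only [mul_comm (v _)] at this
    linarith
  -- restricted strong convexity
  have hMpd : ∀ v : S → ℝ, 11 / 12 * C * ∑ i, v i ^ 2 ≤ ∑ i, v i * ∑ j : S, M i j * v j := by
    intro v
    have h1 : ∑ i, v i * ∑ j : S, M i j * v j =
        ∑ i, v i * ∑ j : S, Q i j * v j + ∑ i, v i * ∑ j : S, (M i j - Q i j) * v j := by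
      rw [← Finset.sum_add_distrib]
      refine Finset.sum_congr rfl fun i _ => ?_
      rw [← mul_add, ← Finset.sum_add_distrib]
      congr 1
      exact Finset.sum_congr rfl fun j _ => by ring
    have h2 := abs_sum_mul_le_of_forall_le (u := v)
      (v := fun i : S => ∑ j : S, (M i j - Q i j) * v j) (fun i => hEv v i)
    -- Since ‖v‖₁² ≤ k‖v‖₂² and ek ≤ C/12, the entrywise error costs at most a twelfth of the
    -- curvature, hence the factor 11/12.
    have h3 : (∑ i, |v i|) * (e * ∑ j, |v j|) ≤ C / 12 * ∑ i, v i ^ 2 := by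
      calc (∑ i, |v i|) * (e * ∑ j, |v j|) = e * (∑ i, |v i|) ^ 2 := by ring
        _ ≤ e * (k * ∑ i, v i ^ 2) := by gcongr; exact hl1 v
        _ = (e * k) * ∑ i, v i ^ 2 := by ring
        _ ≤ (C / 12) * ∑ i, v i ^ 2 := by
            have : 0 ≤ ∑ i, v i ^ 2 := Finset.sum_nonneg fun i _ => sq_nonneg _
            have h : α * C / 12 ≤ C / 12 := by nlinarith
            exact mul_le_mul_of_nonneg_right (hek.trans h) this
    have h4 := (abs_le.1 h2).1
    have h5 := hQ v
    rw [h1]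
    linarith
  have hpd0 : ∀ v : S → ℝ, ∑ i, v i * ∑ j : S, M i j * v j = 0 → v = 0 := by
    intro v hv
    have h1 := hMpd v
    have h2 : 0 ≤ ∑ i, v i ^ 2 := Finset.sum_nonneg fun i _ => sq_nonneg _
    have h3 : ∑ i, v i ^ 2 = 0 := by nlinarith
    funext i
    have := (Finset.sum_eq_zero_iff_of_nonneg fun i _ => sq_nonneg (v i)).1 h3 i
      (Finset.mem_univ i)
    simpa using this
  -- the restricted linear system
  let N : Matrix S S ℝ := M.submatrix (fun i => (i : ι)) (fun j => (j : ι))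
  have hNinj : Function.Injective (Matrix.toLin' N) := by
    rw [← LinearMap.ker_eq_bot, LinearMap.ker_eq_bot']
    intro v hv
    apply hpd0
    refine Finset.sum_eq_zero fun i _ => ?_
    have : (N *ᵥ v) i = 0 := by
      rw [← Matrix.toLin'_apply, hv]; rfl
    have h' : ∑ j : S, M i j * v j = 0 := this
    rw [h', mul_zero]
  obtain ⟨D, hD⟩ := (LinearMap.injective_iff_surjective.1 hNinj)
    (fun i => g i - lam * (SignType.sign (a₀ i) : ℝ))
  have hD : ∀ i : S, ∑ j : S, M i j * D j = g i - lam * (SignType.sign (a₀ i) : ℝ) := by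
    intro i
    have := congrFun hD i
    rw [Matrix.toLin'_apply] at this
    exact this
  have hrhs : ∀ i : S, |g i - lam * (SignType.sign (a₀ i) : ℝ)| ≤ lam * (1 + α / 3) := by
    intro i
    have h1 : |(SignType.sign (a₀ i) : ℝ)| ≤ 1 := by
      rcases lt_trichotomy (a₀ i) 0 with h3 | h3 | h3
      · rw [sign_neg h3]; simp
      · rw [h3]; simp
      · rw [sign_pos h3]; simp
    calc _ ≤ |g i| + |lam * (SignType.sign (a₀ i) : ℝ)| := abs_sub _ _
      _ ≤ lam * α / 3 + lam * 1 := by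
          rw [abs_mul, abs_of_pos hlam]
          gcongr
          exact hg i
      _ = _ := by ring
  -- Pairing the system with D gives (11/12)C‖D‖₁² ≤ k‖D‖₁ · (4/3)λ, and (4/3)(12/11) = 16/11.
  have hDl1 : ∑ i, |D i| ≤ 16 * k * lam / (11 * C) := by
    have h1 := hMpd D
    simp only [hD] at h1
    have h2 := (abs_le.1 (abs_sum_mul_le_of_forall_le (u := D) hrhs)).2
    have h3 := hl1 D
    have h0 : 0 ≤ ∑ i, |D i| := Finset.sum_nonneg fun i _ => abs_nonneg _
    have hk0 : 0 ≤ k := le_trans (Nat.cast_nonneg _) hk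
    rcases h0.eq_or_lt with h4 | h4
    · rw [← h4]; positivity
    · have h5 : 11 / 12 * C * (∑ i, |D i|) ^ 2 ≤ k * ((∑ i, |D i|) * (lam * (4 / 3))) := by
        calc _ ≤ 11 / 12 * C * (k * ∑ i, D i ^ 2) := by gcongr
          _ = k * (11 / 12 * C * ∑ i, D i ^ 2) := by ring
          _ ≤ k * ((∑ i, |D i|) * (lam * (1 + α / 3))) := by
              exact mul_le_mul_of_nonneg_left (h1.trans h2) hk0
          _ ≤ _ := by gcongr; linarith
      have h6 : 11 / 12 * C * (∑ i, |D i|) ≤ k * (lam * (4 / 3)) := by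
        have : (∑ i, |D i|) * (11 / 12 * C * (∑ i, |D i|)) ≤
          (∑ i, |D i|) * (k * (lam * (4 / 3))) := by linarith
        exact le_of_mul_le_mul_left this h4
      rw [le_div_iff₀ (by positivity)]
      linarith
  have hED : e * ∑ i, |D i| ≤ 4 / 33 * α * lam := by
    calc e * ∑ i, |D i| ≤ e * (16 * k * lam / (11 * C)) := by gcongr
      _ = (e * k) * (16 * lam / (11 * C)) := by ring
      _ ≤ (α * C / 12) * (16 * lam / (11 * C)) := by gcongr
      _ = _ := by field_simp; norm_num
  let Δ : ι → ℝ := fun j => if h : j ∈ S then D ⟨j, h⟩ else 0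
  have hsum : ∀ v : ι → ℝ, (∀ j, j ∉ S → v j = 0) → ∀ f : ι → ℝ,
      ∑ j, f j * v j = ∑ j : S, f j * v j := by
    intro v hv f
    rw [Finset.sum_coe_sort S (fun j => f j * v j)]
    exact (Finset.sum_subset (Finset.subset_univ S) fun j _ hj => by rw [hv j hj, mul_zero]).symm
  have hΔS : ∀ j : S, Δ j = D j := by intro j; simp [Δ]
  have hΔoff : ∀ j, j ∉ S → Δ j = 0 := by intro j hj; simp [Δ, hj]
  have hMΔ : ∀ i, (M *ᵥ Δ) i = ∑ j : S, M i j * D j := by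
    intro i
    have := hsum Δ hΔoff (M i)
    simp only [hΔS] at this
    exact this
  have hnot : ∀ j, a₀ j = 0 → j ∉ S := fun j hj h => (hS j).1 h hj
  refine lasso_recovery_of_witness hM hpsd hlam ?_ (Δ := Δ) (fun j hj => hΔoff j (hnot j hj))
    ?_ ?_ ?_
  · intro v hv h0
    have hv' : ∀ j, j ∉ S → v j = 0 := fun j hj => hv j (by
      by_contra h; exact hj ((hS j).2 h))
    have h1 : ∑ i : S, v i * ∑ j : S, M i j * v j = 0 := by
      rw [← h0]
      have h2 : v ⬝ᵥ M *ᵥ v = ∑ i, (M *ᵥ v) i * v i := dotProduct_comm _ _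
      rw [h2, hsum v hv']
      refine Finset.sum_congr rfl fun i _ => ?_
      rw [mul_comm]
      congr 1
      exact (hsum v hv' (M i)).symm
    have h2 := hpd0 (fun i => v i) h1
    funext j
    by_cases hj : j ∈ S
    · exact congrFun h2 ⟨j, hj⟩
    · exact hv' j hj
  · intro j hj
    have hjS := (hS j).2 hj
    refine lt_of_le_of_lt ?_ (hmin j hjS)
    have h1 : Δ j = D ⟨j, hjS⟩ := hΔS ⟨j, hjS⟩
    rw [h1]
    exact (Finset.single_le_sum (f := fun i => |D i|) (fun i _ => abs_nonneg _)
      (Finset.mem_univ (⟨j, hjS⟩ : S))).trans hDl1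
  · intro j hj
    rw [hMΔ, hD ⟨j, (hS j).2 hj⟩]; simp
  · intro i hi
    obtain ⟨u, hu, huQ⟩ := hinc i (hnot i hi)
    rw [hMΔ]
    -- Row i of Q on S is a combination `u` of the rows in S. So (MΔ) i is the same combination of
    -- the known right-hand sides, up to two errors each at most (4/33)αλ.
    have h1 : ∑ j : S, M i j * D j = ∑ l, u l * (g l - lam * (SignType.sign (a₀ l) : ℝ)) -
        ∑ l, u l * ∑ j : S, (M l j - Q l j) * D j + ∑ j : S, (M i j - Q i j) * D j := by
      have h2 : ∑ j : S, Q i j * D j = ∑ l, u l * ∑ j : S, Q l j * D j := by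
        simp only [huQ, Finset.sum_mul, Finset.mul_sum]
        rw [Finset.sum_comm]
        exact Finset.sum_congr rfl fun _ _ => Finset.sum_congr rfl fun _ _ => by ring
      have h3 : ∀ l : ι, ∑ j : S, (M l j - Q l j) * D j =
          ∑ j : S, M l j * D j - ∑ j : S, Q l j * D j := by
        intro l
        simp only [sub_mul, Finset.sum_sub_distrib]
      simp only [h3, mul_sub, Finset.sum_sub_distrib, hD, h2]
      ring
    have h4 := abs_sum_mul_le_of_forall_le (u := u) hrhs
    have h5 := abs_sum_mul_le_of_forall_le (u := u)
      (v := fun l : S => ∑ j : S, (M l j - Q l j) * D j) (fun l => hEv D l)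
    have h6 := hEv D i
    have h7 : (∑ l, |u l|) * (lam * (1 + α / 3)) ≤ (1 - α) * (lam * (1 + α / 3)) := by
      gcongr
    have h8 : (∑ l, |u l|) * (e * ∑ j, |D j|) ≤ 1 * (4 / 33 * α * lam) := by
      have : 0 ≤ e * ∑ j, |D j| := mul_nonneg he (Finset.sum_nonneg fun _ _ => abs_nonneg _)
      have h0 : 0 ≤ ∑ l, |u l| := Finset.sum_nonneg fun _ _ => abs_nonneg _
      exact mul_le_mul (by linarith) hED this zero_le_one
    have h9 := hg i
    -- The left side equals λ(1 - α/11 - α²/3).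
    have hfin : lam * α / 3 + (1 - α) * (lam * (1 + α / 3)) + 2 * (4 / 33 * α * lam) < lam := by
      have : 0 < lam * α := by positivity
      nlinarith [mul_pos this hα]
    rw [h1]
    rw [abs_le] at h4 h5 h6 h9
    rw [abs_lt]
    constructor <;> linarith [h4.1, h4.2, h5.1, h5.2, h6.1, h6.2, h9.1, h9.2]

end Lasso

/-! ### The Lyapunov equation Q = BQB* + ηI for a contraction B. -/

section Lyapunov

open ContinuousLinearMap

variable {F : Type*} [NormedAddCommGroup F] [InnerProductSpace ℝ F] [CompleteSpace F]
  {B Q : F →L[ℝ] F} {η σ : ℝ}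

lemma norm_adjoint_apply_sq_le (hB : ‖B‖ ≤ σ) (v : F) : ‖adjoint B v‖ ^ 2 ≤ σ ^ 2 * ‖v‖ ^ 2 := by
  rw [← mul_pow]
  gcongr
  refine (adjoint B).le_of_opNorm_le ?_ v
  rwa [LinearIsometryEquiv.norm_map]

lemma lyapunov_inner (hQ : Q = B ∘L Q ∘L adjoint B + η • ContinuousLinearMap.id ℝ F) (v : F) :
    ⟪Q v, v⟫ = ⟪Q (adjoint B v), adjoint B v⟫ + η * ‖v‖ ^ 2 := by
  conv_lhs => rw [hQ]
  simp [inner_add_left, real_inner_smul_left, adjoint_inner_right]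

/-- The difference X = Q - Q* solves X = BXB*, so ‖X‖ ≤ σ²‖X‖ and X = 0. -/
lemma lyapunov_isSymmetric (hQ : Q = B ∘L Q ∘L adjoint B + η • ContinuousLinearMap.id ℝ F)
    (hB : ‖B‖ ≤ σ) (hσ : σ < 1) : adjoint Q = Q := by
  have h1 : adjoint Q = B ∘L adjoint Q ∘L adjoint B + η • ContinuousLinearMap.id ℝ F := by
    have hid : adjoint (η • ContinuousLinearMap.id ℝ F) = η • ContinuousLinearMap.id ℝ F :=
      ((eq_adjoint_iff _ _).2 fun x y => by simp [inner_smul_left, inner_smul_right]).symm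
    conv_lhs => rw [hQ]
    rw [map_add, adjoint_comp, adjoint_comp, adjoint_adjoint, hid, comp_assoc]
  have h2 : Q - adjoint Q = B ∘L (Q - adjoint Q) ∘L adjoint B := by
    calc Q - adjoint Q = (B ∘L Q ∘L adjoint B + η • ContinuousLinearMap.id ℝ F) -
          (B ∘L adjoint Q ∘L adjoint B + η • ContinuousLinearMap.id ℝ F) := by rw [← hQ, ← h1]
      _ = _ := by rw [sub_comp, comp_sub]; abel
  have h0 : 0 ≤ σ := (norm_nonneg B).trans hB
  have h3 : ‖Q - adjoint Q‖ ≤ σ * (‖Q - adjoint Q‖ * σ) := by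
    conv_lhs => rw [h2]
    refine (opNorm_comp_le _ _).trans ?_
    gcongr
    refine (opNorm_comp_le _ _).trans ?_
    gcongr
    rwa [LinearIsometryEquiv.norm_map]
  have h4 : ‖Q - adjoint Q‖ = 0 := by
    have := norm_nonneg (Q - adjoint Q)
    have hs : σ * σ < 1 := by nlinarith
    nlinarith
  exact (sub_eq_zero.1 (norm_eq_zero.1 h4)).symm

lemma tendsto_geometric_error (hσ0 : 0 ≤ σ) (hσ : σ < 1) (c d e : ℝ) :
    Filter.Tendsto (fun m : ℕ => c * (σ ^ 2) ^ m * d + e) Filter.atTop (nhds e) := by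
  have h : σ ^ 2 < 1 := by nlinarith
  have := ((tendsto_pow_atTop_nhds_zero_of_lt_one (sq_nonneg σ) h).const_mul c).mul_const d
  simpa using this.add_const e

/-- Iterating the equation m times improves the trivial bound -‖Q‖‖v‖² by the factor σ^(2m); then m
→ ∞. The upper bound below is obtained in the same way. -/
lemma lyapunov_nonneg (hQ : Q = B ∘L Q ∘L adjoint B + η • ContinuousLinearMap.id ℝ F)
    (hB : ‖B‖ ≤ σ) (hσ : σ < 1) (hη : 0 ≤ η) (v : F) : 0 ≤ ⟪Q v, v⟫ := by
  have h0 : 0 ≤ σ := (norm_nonneg B).trans hB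
  have h : ∀ m : ℕ, ∀ v, -‖Q‖ * (σ ^ 2) ^ m * ‖v‖ ^ 2 + 0 ≤ ⟪Q v, v⟫ := by
    intro m
    induction m with
    | zero =>
      intro v
      have h1 := (abs_le.1 (abs_real_inner_le_norm (Q v) v)).1
      have h2 := Q.le_opNorm v
      nlinarith [norm_nonneg v]
    | succ m ih =>
      intro v
      rw [lyapunov_inner hQ]
      have h1 := ih (adjoint B v)
      have h2 : ‖Q‖ * (σ ^ 2) ^ m * ‖adjoint B v‖ ^ 2 ≤
          ‖Q‖ * (σ ^ 2) ^ m * (σ ^ 2 * ‖v‖ ^ 2) := by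
        gcongr
        exact norm_adjoint_apply_sq_le hB v
      have h3 : 0 ≤ η * ‖v‖ ^ 2 := by positivity
      rw [pow_succ (σ ^ 2)]
      linarith
  exact le_of_tendsto' (tendsto_geometric_error h0 hσ _ _ _) fun m => h m v

lemma lyapunov_lower (hQ : Q = B ∘L Q ∘L adjoint B + η • ContinuousLinearMap.id ℝ F)
    (hB : ‖B‖ ≤ σ) (hσ : σ < 1) (hη : 0 ≤ η) (v : F) : η * ‖v‖ ^ 2 ≤ ⟪Q v, v⟫ := by
  rw [lyapunov_inner hQ]
  have := lyapunov_nonneg hQ hB hσ hη (adjoint B v)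
  linarith

lemma lyapunov_upper (hQ : Q = B ∘L Q ∘L adjoint B + η • ContinuousLinearMap.id ℝ F)
    (hB : ‖B‖ ≤ σ) (hσ : σ < 1) (hη : 0 ≤ η) (v : F) : ⟪Q v, v⟫ ≤ η / (1 - σ) * ‖v‖ ^ 2 := by
  have h0 : 0 ≤ σ := (norm_nonneg B).trans hB
  have h1σ : 0 < 1 - σ := by linarith
  have h : ∀ m : ℕ, ∀ v, ⟪Q v, v⟫ ≤ ‖Q‖ * (σ ^ 2) ^ m * ‖v‖ ^ 2 + η / (1 - σ) * ‖v‖ ^ 2 := by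
    intro m
    induction m with
    | zero =>
      intro v
      have h1 := (abs_le.1 (abs_real_inner_le_norm (Q v) v)).2
      have h2 := Q.le_opNorm v
      have : 0 ≤ η / (1 - σ) * ‖v‖ ^ 2 := by positivity
      nlinarith [norm_nonneg v]
    | succ m ih =>
      intro v
      rw [lyapunov_inner hQ]
      have h1 := ih (adjoint B v)
      have h2 : (‖Q‖ * (σ ^ 2) ^ m + η / (1 - σ)) * ‖adjoint B v‖ ^ 2 ≤
          (‖Q‖ * (σ ^ 2) ^ m + η / (1 - σ)) * (σ ^ 2 * ‖v‖ ^ 2) := by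
        gcongr
        exact norm_adjoint_apply_sq_le hB v
      -- The sharp constant would be η/(1-σ²); the weaker η/(1-σ) is 1/D exactly.
      have h3 : η / (1 - σ) * σ ^ 2 + η ≤ η / (1 - σ) := by
        have : η = η / (1 - σ) * (1 - σ) := by field_simp
        have h4 : η / (1 - σ) * σ ^ 2 ≤ η / (1 - σ) * σ := by
          gcongr; nlinarith
        linarith
      have h5 := mul_le_mul_of_nonneg_right h3 (sq_nonneg ‖v‖)
      rw [pow_succ (σ ^ 2)]
      linarith
  exact ge_of_tendsto' (tendsto_geometric_error h0 hσ _ _ _) fun m => h m v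

end Lyapunov

/-! ### Singular values, least eigenvalue, incoherence and row support. -/

section MatrixFacts

open Matrix

variable {p : ℕ}

/-- Expand ‖Mv‖² in an eigenbasis of M*M, whose eigenvalues are the squared singular values; the one
of index 0 is the largest. -/
lemma norm_toEuclideanCLM_le_sigmaMax (M : Matrix (Fin p) (Fin p) ℝ) :
    ‖toEuclideanCLM (𝕜 := ℝ) M‖ ≤ sigmaMax M := by
  set T := toEuclideanLin M with hT
  have h0 : 0 ≤ sigmaMax M := LinearMap.singularValues_nonneg _ _
  refine ContinuousLinearMap.opNorm_le_bound _ h0 fun v => ?_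
  have hv : toEuclideanCLM (𝕜 := ℝ) M v = T v := rfl
  rw [hv]
  refine abs_le_of_sq_le_sq' ?_ (by positivity) |>.2
  have h1 : ‖T v‖ ^ 2 = ⟪(LinearMap.adjoint T ∘ₗ T) v, v⟫ := by
    rw [LinearMap.comp_apply, LinearMap.adjoint_inner_left, real_inner_self_eq_norm_sq]
  have hS := T.isSymmetric_adjoint_comp_self
  rw [h1, inner_self_eq_sum_eigenvalues hS, mul_pow,
    ← (hS.eigenvectorBasis rfl).sum_sq_inner_right v, Finset.mul_sum]
  refine Finset.sum_le_sum fun i _ => ?_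
  gcongr
  rw [← T.sq_singularValues_fin rfl i]
  have : T.singularValues i ≤ sigmaMax M := T.singularValues_antitone (Nat.zero_le _)
  have := T.singularValues_nonneg i
  gcongr

lemma lambdaMin_le_eigenvalue {ι : Type*} [Fintype ι] [DecidableEq ι] {M : Matrix ι ι ℝ}
    {x : ℝ} (hx : x ∈ spectrum ℝ M) : lambdaMin M ≤ x :=
  csInf_le M.finite_real_spectrum.bddBelow hx

lemma lambdaMin_mul_le {ι : Type*} [Fintype ι] [DecidableEq ι] {M : Matrix ι ι ℝ}
    (hM : M.IsHermitian) (v : ι → ℝ) :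
    lambdaMin M * ∑ i, v i ^ 2 ≤ ∑ i, v i * ∑ j, M i j * v j := by
  have h : (M - algebraMap ℝ _ (lambdaMin M)).PosSemidef := by
    rw [posSemidef_iff_isHermitian_and_spectrum_nonneg]
    refine ⟨hM.sub (by rw [Algebra.algebraMap_eq_smul_one]; simp [IsHermitian]), ?_⟩
    intro x hx
    have hx' : x + lambdaMin M ∈ spectrum ℝ M := by
      rw [sub_eq_add_neg, add_comm, ← spectrum.add_mem_iff] at hx
      simpa [add_comm] using hx
    have := lambdaMin_le_eigenvalue hx'
    simp; linarith
  have h1 := h.dotProduct_mulVec_nonneg v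
  rw [sub_mulVec, dotProduct_sub, Algebra.algebraMap_eq_smul_one, smul_mulVec, one_mulVec,
    dotProduct_smul] at h1
  simp only [star_trivial, smul_eq_mul, dotProduct, mulVec, ← sq] at h1
  linarith

lemma isUnit_det_of_lambdaMin_pos {ι : Type*} [Fintype ι] [DecidableEq ι] {M : Matrix ι ι ℝ}
    (h : 0 < lambdaMin M) : IsUnit M.det := by
  rw [← isUnit_iff_isUnit_det]
  by_contra hu
  have : (0 : ℝ) ∈ spectrum ℝ M := spectrum.zero_mem_iff ℝ |>.2 hu
  exact absurd (lambdaMin_le_eigenvalue this) (not_le.2 h)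

section
attribute [local instance] Matrix.linftyOpNormedAddCommGroup

lemma sum_abs_le_supOpNorm {ι κ : Type*} [Fintype ι] [Fintype κ] (M : Matrix ι κ ℝ) (i : ι) :
    ∑ j, |M i j| ≤ supOpNorm M := by
  have h : ∑ j, ‖M i j‖₊ ≤ ‖M‖₊ := by
    rw [linfty_opNNNorm_def]
    exact Finset.le_sup (f := fun i => ∑ j, ‖M i j‖₊) (Finset.mem_univ i)
  have := NNReal.coe_le_coe.2 h
  push_cast at this
  simpa only [supOpNorm, Real.norm_eq_abs] using this

lemma supOpNorm_nonneg {ι κ : Type*} [Fintype ι] [Fintype κ] (M : Matrix ι κ ℝ) :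
    0 ≤ supOpNorm M := norm_nonneg M

end

lemma incoherence_le_one (A Q : Matrix (Fin p) (Fin p) ℝ) (r : Fin p) :
    incoherence A Q r ≤ 1 := by
  have := supOpNorm_nonneg (block Q (rowSupport A r)ᶜ (rowSupport A r) *
    (block Q (rowSupport A r) (rowSupport A r))⁻¹)
  unfold incoherence; linarith

lemma exists_incoherent_row {A Q : Matrix (Fin p) (Fin p) ℝ} {r : Fin p}
    (hC : 0 < Cmin A Q r) (i : Fin p) (hi : i ∉ rowSupport A r) :
    ∃ u : rowSupport A r → ℝ, ∑ l, |u l| ≤ 1 - incoherence A Q r ∧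
      ∀ j : rowSupport A r, Q i j = ∑ l, u l * Q l j := by
  have hi' : i ∈ (rowSupport A r)ᶜ := by simpa using hi
  set S := rowSupport A r with hS
  refine ⟨fun l => (block Q Sᶜ S * (block Q S S)⁻¹) ⟨i, hi'⟩ l, ?_, fun j => ?_⟩
  · refine (sum_abs_le_supOpNorm _ _).trans ?_
    rw [incoherence, sub_sub_cancel]
  · have h := nonsing_inv_mul_cancel_right (A := block Q S S) (block Q Sᶜ S)
      (isUnit_det_of_lambdaMin_pos hC)
    have h2 := congrFun (congrFun h ⟨i, hi'⟩) j
    rw [mul_apply] at h2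
    exact h2.symm

/-- Over an empty index type the spectrum is empty and `sInf ∅ = 0`, so a positive `Cmin` excludes
an empty support. The bound k ≥ 1 rests on this. -/
lemma rowSupport_nonempty {A Q : Matrix (Fin p) (Fin p) ℝ} {r : Fin p}
    (hC : 0 < Cmin A Q r) : (rowSupport A r).Nonempty := by
  by_contra h
  have he : IsEmpty (rowSupport A r) := by
    rw [Finset.not_nonempty_iff_eq_empty] at h
    rw [h]; infer_instance
  unfold Cmin lambdaMin at hC
  rw [spectrum.of_subsingleton, Real.sInf_empty] at hC
  exact lt_irrefl _ hC

lemma Amin_le {A : Matrix (Fin p) (Fin p) ℝ} {r j : Fin p} (hj : j ∈ rowSupport A r) :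
    Amin A r ≤ |A r j| :=
  ciInf_le (f := fun j : rowSupport A r => |A r j|) (Set.finite_range _).bddBelow ⟨j, hj⟩

lemma Amin_pos {A : Matrix (Fin p) (Fin p) ℝ} {r : Fin p} (h : (rowSupport A r).Nonempty) :
    0 < Amin A r := by
  have : Nonempty (rowSupport A r) := h.to_subtype
  obtain ⟨j, hj⟩ := exists_eq_ciInf_of_finite (f := fun j : rowSupport A r => |A r j|)
  unfold Amin
  rw [← hj]
  have := (Finset.mem_filter.1 j.2).2
  exact abs_pos.2 this

end MatrixFacts

/-! ### The trajectory as a linear function of the noise; energy and covariance. -/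

section StateSpace

open ContinuousLinearMap

variable {F : Type*} [NormedAddCommGroup F] [InnerProductSpace ℝ F]

/-- The space of normalised noise sequences of length `n + 1`. -/
abbrev NoiseSpace (F : Type*) (n : ℕ) : Type _ := PiLp 2 (fun _ : Fin (n + 1) => F)

/-- The noise at time `t` (zero beyond the horizon). -/
def coord (F : Type*) [NormedAddCommGroup F] [InnerProductSpace ℝ F] (n t : ℕ) :
    NoiseSpace F n →L[ℝ] F :=
  if h : t < n + 1 then PiLp.proj (𝕜 := ℝ) 2 (fun _ => F) ⟨t, h⟩ else 0

/-- The state at time `t` of the recursion `x (t+1) = B x t + √η z (t+1)`, `x 0 = L (z 0)`, as a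
linear function of the noise `z`. -/
def stateOp (n : ℕ) (L B : F →L[ℝ] F) (η : ℝ) : ℕ → (NoiseSpace F n →L[ℝ] F)
  | 0 => L ∘L coord F n 0
  | t + 1 => B ∘L stateOp n L B η t + √η • coord F n (t + 1)

lemma coord_apply {n t : ℕ} (h : t < n + 1) (z : NoiseSpace F n) :
    coord F n t z = z ⟨t, h⟩ := by
  simp [coord, h]

lemma sum_norm_coord_sq (n : ℕ) (z : NoiseSpace F n) :
    ∑ t ∈ Finset.range (n + 1), ‖coord F n t z‖ ^ 2 = ‖z‖ ^ 2 := by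
  rw [PiLp.norm_sq_eq_of_L2, Finset.sum_range]
  exact Finset.sum_congr rfl fun i _ => by rw [coord_apply i.2]

variable {n : ℕ} {L B Q : F →L[ℝ] F} {η σ : ℝ}

lemma norm_stateOp_succ_sq_le (hB : ‖B‖ ≤ σ) (hσ : σ < 1) (hη : 0 ≤ η) (t : ℕ)
    (z : NoiseSpace F n) :
    ‖stateOp n L B η (t + 1) z‖ ^ 2 ≤
      σ * ‖stateOp n L B η t z‖ ^ 2 + η / (1 - σ) * ‖coord F n (t + 1) z‖ ^ 2 := by
  have h0 : 0 ≤ σ := (norm_nonneg B).trans hB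
  have h1 : 0 < 1 - σ := by linarith
  set u := ‖stateOp n L B η t z‖
  set v := ‖coord F n (t + 1) z‖
  have h2 : ‖stateOp n L B η (t + 1) z‖ ≤ σ * u + √η * v := by
    simp only [stateOp, add_apply, comp_apply, smul_apply]
    refine (norm_add_le _ _).trans (add_le_add (B.le_of_opNorm_le hB _) ?_)
    rw [norm_smul, Real.norm_of_nonneg (Real.sqrt_nonneg _)]
  -- Convexity of the square with weights σ and 1-σ, at the points u and wv/(1-σ).
  have h3 : ∀ w : ℝ, (σ * u + w * v) ^ 2 ≤ σ * u ^ 2 + w ^ 2 / (1 - σ) * v ^ 2 := by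
    intro w
    have : σ * u ^ 2 + w ^ 2 / (1 - σ) * v ^ 2 - (σ * u + w * v) ^ 2 =
        σ / (1 - σ) * ((1 - σ) * u - w * v) ^ 2 := by
      field_simp
      ring
    have h4 : 0 ≤ σ / (1 - σ) * ((1 - σ) * u - w * v) ^ 2 := by positivity
    linarith
  calc _ ≤ (σ * u + √η * v) ^ 2 := by gcongr
    _ ≤ _ := by simpa only [Real.sq_sqrt hη] using h3 √η

/-- Summing the one-step inequality telescopes. The resulting operator bound does not depend on the
horizon n. -/
lemma sum_norm_stateOp_sq_le (hL : ∀ v, ‖L v‖ ^ 2 ≤ η / (1 - σ) * ‖v‖ ^ 2) (hB : ‖B‖ ≤ σ)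
    (hσ : σ < 1) (hη : 0 ≤ η) (z : NoiseSpace F n) :
    ∑ t ∈ Finset.range n, ‖stateOp n L B η t z‖ ^ 2 ≤ η / (1 - σ) ^ 2 * ‖z‖ ^ 2 := by
  have h1 : 0 < 1 - σ := by linarith
  have h : ∀ m, (1 - σ) * ∑ t ∈ Finset.range m, ‖stateOp n L B η t z‖ ^ 2 +
      ‖stateOp n L B η m z‖ ^ 2 ≤
      η / (1 - σ) * ∑ t ∈ Finset.range (m + 1), ‖coord F n t z‖ ^ 2 := by
    intro m
    induction m with
    | zero => simpa [stateOp] using hL (coord F n 0 z)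
    | succ m ih =>
      have := norm_stateOp_succ_sq_le (L := L) hB hσ hη m z
      rw [Finset.sum_range_succ, Finset.sum_range_succ _ (m + 1)]
      linarith
  have h2 := h n
  rw [sum_norm_coord_sq] at h2
  have h3 : η / (1 - σ) ^ 2 * ‖z‖ ^ 2 = (η / (1 - σ) * ‖z‖ ^ 2) / (1 - σ) := by field_simp
  rw [h3, le_div_iff₀ h1]
  linarith [sq_nonneg ‖stateOp n L B η n z‖]

variable [FiniteDimensional ℝ F]

lemma adjoint_coord_apply {n t : ℕ} (h : t < n + 1) (u : F) :
    adjoint (coord F n t) u = PiLp.single 2 ⟨t, h⟩ u := by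
  refine ext_inner_left ℝ fun z => ?_
  rw [adjoint_inner_right, coord_apply h, PiLp.inner_apply, Finset.sum_eq_single ⟨t, h⟩]
  · simp
  · intro i _ hi; rw [PiLp.single_eq_of_ne _ hi, inner_zero_right]
  · simp

lemma coord_adjoint_coord_self {n t : ℕ} (h : t ≤ n) (u : F) :
    coord F n t (adjoint (coord F n t) u) = u := by
  rw [adjoint_coord_apply (Nat.lt_succ_of_le h), coord_apply (Nat.lt_succ_of_le h)]
  simp

lemma coord_adjoint_coord_of_ne {n s t : ℕ} (hst : s ≠ t) (u : F) :
    coord F n s (adjoint (coord F n t) u) = 0 := by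
  by_cases ht : t < n + 1
  · by_cases hs : s < n + 1
    · rw [adjoint_coord_apply ht, coord_apply hs, PiLp.single_eq_of_ne]
      simpa using hst
    · simp [coord, hs]
  · have : coord F n t = 0 := by simp [coord, ht]
    simp [this]

/-- Causality: the state at time s does not involve later noise. -/
lemma stateOp_adjoint_coord {s t : ℕ} (hst : s < t) (u : F) :
    stateOp n L B η s (adjoint (coord F n t) u) = 0 := by
  induction s with
  | zero => simp [stateOp, coord_adjoint_coord_of_ne hst.ne]
  | succ s ih =>
    simp [stateOp, ih (by omega), coord_adjoint_coord_of_ne hst.ne]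

/-- Stationarity: every state has covariance Q. Cross terms vanish by causality, and what remains is
the Lyapunov equation. -/
lemma stateOp_adjoint_self (hL : L ∘L adjoint L = Q)
    (hQ : Q = B ∘L Q ∘L adjoint B + η • ContinuousLinearMap.id ℝ F) (hη : 0 ≤ η)
    {t : ℕ} (ht : t ≤ n) (u : F) :
    stateOp n L B η t (adjoint (stateOp n L B η t) u) = Q u := by
  induction t generalizing u with
  | zero =>
    simp only [stateOp, adjoint_comp, comp_apply, coord_adjoint_coord_self (Nat.zero_le n)]
    rw [← hL]; rfl
  | succ t ih =>
    have hadj : adjoint (stateOp n L B η (t + 1)) u =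
        adjoint (stateOp n L B η t) (adjoint B u) + √η • adjoint (coord F n (t + 1)) u := by
      refine ext_inner_left ℝ fun z => ?_
      simp [stateOp, adjoint_inner_right, inner_add_right, real_inner_smul_right]
    have hz : coord F n (t + 1) (adjoint (stateOp n L B η t) (adjoint B u)) = 0 := by
      refine ext_inner_left ℝ fun v => ?_
      rw [← adjoint_inner_left, adjoint_inner_right, stateOp_adjoint_coord (Nat.lt_succ_self t)]
      simp
    rw [hadj]
    conv_rhs => rw [hQ]
    simp only [stateOp, add_apply, comp_apply, map_add, map_smul, smul_apply, ih (by omega), hz,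
      stateOp_adjoint_coord (Nat.lt_succ_self t), coord_adjoint_coord_self ht, id_apply]
    simp [smul_smul, Real.mul_self_sqrt hη]

end StateSpace

/-! ### Tail bounds on the space of noise sequences. -/

section Concentration

open ContinuousLinearMap

variable {p n : ℕ} {L B Q : EuclideanSpace ℝ (Fin p) →L[ℝ] EuclideanSpace ℝ (Fin p)} {η σ : ℝ}

/-- The functional `z ↦ x_i(t)`, as a vector. -/
def stateVec (n : ℕ) (L B : EuclideanSpace ℝ (Fin p) →L[ℝ] EuclideanSpace ℝ (Fin p)) (η : ℝ)
    (i : Fin p) (t : ℕ) : NoiseSpace (EuclideanSpace ℝ (Fin p)) n :=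
  adjoint (stateOp n L B η t) (EuclideanSpace.single i 1)

/-- The functional `z ↦ √η z_r(t)`, as a vector. -/
def noiseVec (n : ℕ) (η : ℝ) (r : Fin p) (t : ℕ) : NoiseSpace (EuclideanSpace ℝ (Fin p)) n :=
  √η • adjoint (coord (EuclideanSpace ℝ (Fin p)) n t) (EuclideanSpace.single r 1)

lemma sq_apply_le_norm_sq (v : EuclideanSpace ℝ (Fin p)) (i : Fin p) : v i ^ 2 ≤ ‖v‖ ^ 2 := by
  rw [EuclideanSpace.real_norm_sq_eq]
  exact Finset.single_le_sum (f := fun i => v i ^ 2) (fun i _ => sq_nonneg _) (Finset.mem_univ i)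

lemma inner_stateVec (i : Fin p) (t : ℕ) (z : NoiseSpace (EuclideanSpace ℝ (Fin p)) n) :
    ⟪stateVec n L B η i t, z⟫ = stateOp n L B η t z i := by
  rw [stateVec, adjoint_inner_left, EuclideanSpace.inner_single_left]; simp

lemma inner_noiseVec (r : Fin p) (t : ℕ) (z : NoiseSpace (EuclideanSpace ℝ (Fin p)) n) :
    ⟪noiseVec n η r t, z⟫ = √η * coord (EuclideanSpace ℝ (Fin p)) n t z r := by
  rw [noiseVec, real_inner_smul_left, adjoint_inner_left, EuclideanSpace.inner_single_left]; simp

lemma inner_stateVec_stateVec (hL : L ∘L adjoint L = Q)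
    (hQ : Q = B ∘L Q ∘L adjoint B + η • ContinuousLinearMap.id ℝ _) (hη : 0 ≤ η)
    {t : ℕ} (ht : t ≤ n) (i j : Fin p) :
    ⟪stateVec n L B η i t, stateVec n L B η j t⟫ = Q (EuclideanSpace.single j 1) i := by
  rw [inner_stateVec, stateVec, stateOp_adjoint_self hL hQ hη ht]

lemma inner_stateVec_noiseVec {s t : ℕ} (hst : s < t) (i r : Fin p) :
    ⟪stateVec n L B η i s, noiseVec n η r t⟫ = 0 := by
  rw [inner_stateVec, noiseVec, map_smul, stateOp_adjoint_coord hst]; simp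

lemma norm_noiseVec_sq (hη : 0 ≤ η) {t : ℕ} (ht : t ≤ n) (r : Fin p) :
    ‖noiseVec n η r t‖ ^ 2 = η := by
  rw [← real_inner_self_eq_norm_sq, inner_noiseVec, noiseVec, map_smul,
    coord_adjoint_coord_self ht]
  simp [Real.mul_self_sqrt hη]

lemma inner_noiseVec_of_ne {s t : ℕ} (hst : s ≠ t) (r : Fin p) :
    ⟪noiseVec n η r s, noiseVec n η r t⟫ = 0 := by
  rw [inner_noiseVec, noiseVec, map_smul, coord_adjoint_coord_of_ne hst]; simp

lemma sum_inner_noiseVec_sq_le (hη : 0 ≤ η) (r : Fin p)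
    (z : NoiseSpace (EuclideanSpace ℝ (Fin p)) n) :
    ∑ t ∈ Finset.range n, ⟪noiseVec n η r (t + 1), z⟫ ^ 2 ≤ η * ‖z‖ ^ 2 := by
  rw [← sum_norm_coord_sq, Finset.sum_range_succ', mul_add, Finset.mul_sum]
  refine le_add_of_le_of_nonneg (Finset.sum_le_sum fun t _ => ?_) (by positivity)
  rw [inner_noiseVec, mul_pow, Real.sq_sqrt hη]
  exact mul_le_mul_of_nonneg_left (sq_apply_le_norm_sq _ _) hη

lemma sum_inner_stateVec_sq_le (hL : ∀ v, ‖L v‖ ^ 2 ≤ η / (1 - σ) * ‖v‖ ^ 2) (hB : ‖B‖ ≤ σ)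
    (hσ : σ < 1) (hη : 0 ≤ η) (i : Fin p) (z : NoiseSpace (EuclideanSpace ℝ (Fin p)) n) :
    ∑ t ∈ Finset.range n, ⟪stateVec n L B η i t, z⟫ ^ 2 ≤ η / (1 - σ) ^ 2 * ‖z‖ ^ 2 := by
  refine (Finset.sum_le_sum fun t _ => ?_).trans (sum_norm_stateOp_sq_le hL hB hσ hη z)
  rw [inner_stateVec]
  exact sq_apply_le_norm_sq _ _

lemma norm_stateVec_sq_le (hL : L ∘L adjoint L = Q)
    (hQ : Q = B ∘L Q ∘L adjoint B + η • ContinuousLinearMap.id ℝ _) (hB : ‖B‖ ≤ σ)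
    (hσ : σ < 1) (hη : 0 ≤ η) {t : ℕ} (ht : t ≤ n) (i : Fin p) :
    ‖stateVec n L B η i t‖ ^ 2 ≤ η / (1 - σ) := by
  rw [← real_inner_self_eq_norm_sq, inner_stateVec_stateVec hL hQ hη ht]
  have := lyapunov_upper hQ hB hσ hη (EuclideanSpace.single i 1)
  rw [EuclideanSpace.inner_single_right] at this
  simpa using this

lemma abs_sum_mul_le_of_sum_sq_le {τ : Type*} {s : Finset τ} {f g : τ → ℝ} {x y c : ℝ}
    (hf : ∑ t ∈ s, f t ^ 2 ≤ x) (hg : ∑ t ∈ s, g t ^ 2 ≤ y) (hc : 0 ≤ c) (hxy : x * y ≤ c ^ 2) :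
    |∑ t ∈ s, f t * g t| ≤ c := by
  apply abs_le_of_sq_le_sq _ hc
  have h1 : 0 ≤ ∑ t ∈ s, f t ^ 2 := Finset.sum_nonneg fun _ _ => sq_nonneg _
  have h2 : 0 ≤ ∑ t ∈ s, g t ^ 2 := Finset.sum_nonneg fun _ _ => sq_nonneg _
  exact (Finset.sum_mul_sq_le_sq_mul_sq s f g).trans
    ((mul_le_mul hf hg h2 (h1.trans hf)).trans hxy)

/-- Concentration of the (unnormalised) gradient of the least squares loss at the truth. -/
theorem gradient_tail (hL : L ∘L adjoint L = Q)
    (hQ : Q = B ∘L Q ∘L adjoint B + η • ContinuousLinearMap.id ℝ _) (hB : ‖B‖ ≤ σ)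
    (hσ : σ < 1) (hη : 0 < η) (hLn : ∀ v, ‖L v‖ ^ 2 ≤ η / (1 - σ) * ‖v‖ ^ 2) (hn : 0 < n)
    (r j : Fin p) {ε : ℝ} (hε : 0 ≤ ε) (hε2 : ε ≤ 1 / 2) :
    (stdGaussian (NoiseSpace (EuclideanSpace ℝ (Fin p)) n)).real
      {z | n * η * ε ≤ |∑ t ∈ Finset.range n,
        ⟪stateVec n L B η j t, z⟫ * ⟪noiseVec n η r (t + 1), z⟫|} ≤
      2 * Real.exp (-(n * η * (1 - σ) / η * ε ^ 2 / 4)) := by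
  have h1 : 0 < 1 - σ := by linarith
  have hn' : (0 : ℝ) < n := Nat.cast_pos.2 hn
  have hmean : ∑ t ∈ Finset.range n, ⟪stateVec n L B η j t, noiseVec n η r (t + 1)⟫ = 0 :=
    Finset.sum_eq_zero fun t _ => inner_stateVec_noiseVec (Nat.lt_succ_self t) j r
  -- Λ comes from Cauchy-Schwarz and the two energy bounds. In the double sum only u = t survives:
  -- noises at distinct times are orthogonal, and of the two mixed products one is 0 by causality.
  -- Hence V, and sΛ ≤ V is ε ≤ 1/2.
  have := sum_inner_mul_inner_stdGaussian_tail (Finset.range n) (stateVec n L B η j)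
    (fun t => noiseVec n η r (t + 1)) (Λ := η / (1 - σ)) (V := n * η * (η / (1 - σ)) / 2)
    (s := n * η * ε) (fun h => ?_) ?_ (by positivity) (by positivity) ?_
  · simp only [hmean, sub_zero] at this
    refine this.trans (le_of_eq ?_)
    congr 2
    field_simp
    ring
  · refine abs_sum_mul_le_of_sum_sq_le (sum_inner_stateVec_sq_le hLn hB hσ hη.le j h)
      (sum_inner_noiseVec_sq_le hη.le r h) (by positivity) (le_of_eq ?_)
    field_simp
  · calc _ ≤ ∑ t ∈ Finset.range n, η * (η / (1 - σ)) := by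
          refine Finset.sum_le_sum fun t ht => ?_
          have htn := Finset.mem_range.1 ht
          rw [Finset.sum_eq_single_of_mem t ht]
          · rw [inner_stateVec_noiseVec (Nat.lt_succ_self t), zero_mul, add_zero,
              real_inner_self_eq_norm_sq, real_inner_self_eq_norm_sq,
              norm_noiseVec_sq hη.le (Nat.succ_le_of_lt htn), mul_comm]
            gcongr
            exact norm_stateVec_sq_le hL hQ hB hσ hη.le htn.le j
          · intro u _ hut
            rw [inner_noiseVec_of_ne (by omega), mul_zero, zero_add]
            rcases lt_or_gt_of_ne hut with h | h
            · rw [real_inner_comm (stateVec n L B η j u), inner_stateVec_noiseVec (s := u) (t := t + 1)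
                (by omega), mul_zero]
            · rw [inner_stateVec_noiseVec (s := t) (t := u + 1) (by omega), zero_mul]
      _ = _ := by simp; ring
  · calc n * η * ε * (η / (1 - σ)) ≤ n * η * (1 / 2) * (η / (1 - σ)) := by gcongr
      _ = _ := by ring

/-- Concentration of the (unnormalised) empirical covariance. -/
theorem covariance_tail (hL : L ∘L adjoint L = Q)
    (hQ : Q = B ∘L Q ∘L adjoint B + η • ContinuousLinearMap.id ℝ _) (hB : ‖B‖ ≤ σ)
    (hσ : σ < 1) (hη : 0 < η) (hLn : ∀ v, ‖L v‖ ^ 2 ≤ η / (1 - σ) * ‖v‖ ^ 2) (hn : 0 < n)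
    (i j : Fin p) {ε : ℝ} (hε : 0 ≤ ε) (hε2 : ε ≤ η / (1 - σ)) :
    (stdGaussian (NoiseSpace (EuclideanSpace ℝ (Fin p)) n)).real
      {z | n * ε ≤ |∑ t ∈ Finset.range n,
        ⟪stateVec n L B η i t, z⟫ * ⟪stateVec n L B η j t, z⟫ -
          n * Q (EuclideanSpace.single j 1) i|} ≤
      2 * Real.exp (-(n * η * ((1 - σ) / η) ^ 3 * ε ^ 2 / 8)) := by
  have h1 : 0 < 1 - σ := by linarith
  have hn' : (0 : ℝ) < n := Nat.cast_pos.2 hn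
  have hmean : ∑ t ∈ Finset.range n, ⟪stateVec n L B η i t, stateVec n L B η j t⟫ =
      n * Q (EuclideanSpace.single j 1) i := by
    rw [Finset.sum_congr rfl fun t ht =>
      inner_stateVec_stateVec hL hQ hη.le (Finset.mem_range.1 ht).le i j]
    simp
  have hsq := fun i (h : NoiseSpace (EuclideanSpace ℝ (Fin p)) n) =>
    sum_inner_stateVec_sq_le hLn hB hσ hη.le i h
  have := sum_inner_mul_inner_stdGaussian_tail (Finset.range n) (stateVec n L B η i)
    (stateVec n L B η j) (Λ := η / (1 - σ) ^ 2) (V := n * (η / (1 - σ) ^ 2 * (η / (1 - σ))))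
    (s := n * ε) (fun h => ?_) ?_ (by positivity) (by positivity) ?_
  · simp only [hmean] at this
    refine this.trans (le_of_eq ?_)
    congr 2
    field_simp
  · refine abs_sum_mul_le_of_sum_sq_le (hsq i h) (hsq j h) (by positivity) (le_of_eq ?_)
    ring
  · calc _ ≤ ∑ t ∈ Finset.range n, 2 * (η / (1 - σ) ^ 2 * (η / (1 - σ))) := by
          refine Finset.sum_le_sum fun t ht => ?_
          have htn := (Finset.mem_range.1 ht).le
          set a := stateVec n L B η i
          set b := stateVec n L B η j
          have hn : ∀ i, η / (1 - σ) ^ 2 * ‖stateVec n L B η i t‖ ^ 2 ≤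
              η / (1 - σ) ^ 2 * (η / (1 - σ)) := fun i => by
            gcongr
            exact norm_stateVec_sq_le hL hQ hB hσ hη.le htn i
          -- The energy bound is applied to the vectors representing the states themselves: it
          -- bounds the sums over u of squared covariances without any estimate of their decay.
          have haa := hsq i (a t)
          have hab := hsq i (b t)
          have hba := hsq j (a t)
          have hbb := hsq j (b t)
          have hterm : ∀ u, ⟪a t, a u⟫ * ⟪b t, b u⟫ + ⟪a t, b u⟫ * ⟪b t, a u⟫ ≤
              (⟪a u, a t⟫ ^ 2 + ⟪b u, b t⟫ ^ 2 + ⟪b u, a t⟫ ^ 2 + ⟪a u, b t⟫ ^ 2) / 2 := by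
            intro u
            rw [real_inner_comm (a u) (a t), real_inner_comm (b u) (b t),
              real_inner_comm (b u) (a t), real_inner_comm (a u) (b t)]
            nlinarith [sq_nonneg (⟪a u, a t⟫ - ⟪b u, b t⟫), sq_nonneg (⟪b u, a t⟫ - ⟪a u, b t⟫)]
          refine (Finset.sum_le_sum fun u _ => hterm u).trans ?_
          rw [← Finset.sum_div]
          simp only [Finset.sum_add_distrib]
          linarith [hn i, hn j]
      _ = _ := by simp; ring
  · calc n * ε * (η / (1 - σ) ^ 2) ≤ n * (η / (1 - σ)) * (η / (1 - σ) ^ 2) := by gcongr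
      _ = _ := by ring

end Concentration

/-! ### Joint law of the whitened initial state and noise. -/

section Law

variable {F : Type*} [NormedAddCommGroup F] [InnerProductSpace ℝ F] [FiniteDimensional ℝ F]
  [MeasurableSpace F] [BorelSpace F] {Ω : Type*} [MeasurableSpace Ω] {P : Measure Ω}

lemma integral_cexp_inner_of_hasLaw_stdGaussian {v : Ω → F} (hv : HasLaw v (stdGaussian F) P)
    (h : F) : ∫ ω, Complex.exp (⟪v ω, h⟫ * Complex.I) ∂P = Complex.exp (-‖h‖ ^ 2 / 2) := by
  rw [← charFun_stdGaussian, ← hv.map_eq, charFun_apply, integral_map hv.aemeasurable]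
  exact Measurable.aestronglyMeasurable (by fun_prop)

/-- The characteristic function factors twice: time 0 against all later times, then across the later
times. -/
lemma hasLaw_toLp_stdGaussian [IsProbabilityMeasure P] {v : ℕ → Ω → F} (hv : ∀ t, HasLaw (v t) (stdGaussian F) P)
    (hind : iIndepFun (fun t => v (t + 1)) P) (h0 : IndepFun (v 0) (fun ω t => v (t + 1) ω) P)
    (n : ℕ) :
    HasLaw (fun ω => (WithLp.toLp 2 (fun i : Fin (n + 1) => v i ω) : NoiseSpace F n))
      (stdGaussian (NoiseSpace F n)) P := by
  have hm : AEMeasurable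
      (fun ω => (WithLp.toLp 2 (fun i : Fin (n + 1) => v i ω) : NoiseSpace F n)) P := by
    refine (WithLp.measurable_toLp 2 _).comp_aemeasurable ?_
    exact aemeasurable_pi_lambda _ fun i => (hv i).aemeasurable
  refine ⟨hm, Measure.ext_of_charFun ?_⟩
  ext h
  rw [charFun_stdGaussian, charFun_apply, integral_map hm
    (Measurable.aestronglyMeasurable (by fun_prop))]
  have hsplit : ∀ ω, Complex.exp
      (⟪(WithLp.toLp 2 (fun i : Fin (n + 1) => v i ω) : NoiseSpace F n), h⟫ * Complex.I) =
      Complex.exp (⟪v 0 ω, h 0⟫ * Complex.I) *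
        ∏ i : Fin n, Complex.exp (⟪v (i + 1) ω, h i.succ⟫ * Complex.I) := by
    intro ω
    rw [PiLp.inner_apply, Fin.sum_univ_succ, ← Complex.exp_sum, ← Complex.exp_add]
    congr 1
    push_cast
    rw [add_mul, Finset.sum_mul]
    simp
  simp only [hsplit]
  have hind' : iIndepFun (fun i : Fin n => v (i + 1)) P :=
    hind.precomp (g := fun i : Fin n => (i : ℕ)) Fin.val_injective
  rw [h0.integral_fun_comp_mul_comp (f := fun y => Complex.exp (⟪y, h 0⟫ * Complex.I))
    (g := fun y : ℕ → F => ∏ i : Fin n, Complex.exp (⟪y i, h i.succ⟫ * Complex.I))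
    (hv 0).aemeasurable (aemeasurable_pi_lambda _ fun t => (hv (t + 1)).aemeasurable)
    (Measurable.aestronglyMeasurable (by fun_prop))
    (Measurable.aestronglyMeasurable (by fun_prop)),
    hind'.integral_fun_prod_comp
      (f := fun i : Fin n => fun y => Complex.exp (⟪y, h i.succ⟫ * Complex.I))
      (fun i => (hv _).aemeasurable) (fun i => Measurable.aestronglyMeasurable (by fun_prop))]
  simp only [integral_cexp_inner_of_hasLaw_stdGaussian (hv _)]
  rw [← Complex.exp_sum, ← Complex.exp_add]
  congr 1
  rw [← Finset.sum_div, Finset.sum_neg_distrib, ← add_div, ← neg_add]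
  congr 2
  have := PiLp.norm_sq_eq_of_L2 (fun _ : Fin (n + 1) => F) h
  rw [Fin.sum_univ_succ] at this
  exact_mod_cast this.symm

end Law

/-! ### Whitening the model. -/

section Whitening

open Matrix

variable {p : ℕ} {Ω : Type*} [MeasurableSpace Ω] {P : Measure Ω}

lemma adjoint_toEuclideanCLM (M : Matrix (Fin p) (Fin p) ℝ) :
    ContinuousLinearMap.adjoint (toEuclideanCLM (𝕜 := ℝ) M) = toEuclideanCLM (𝕜 := ℝ) Mᵀ := by
  rw [← ContinuousLinearMap.star_eq_adjoint, ← map_star, star_eq_conjTranspose,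
    conjTranspose_eq_transpose_of_trivial]

lemma inner_toEuclideanCLM_self (M : Matrix (Fin p) (Fin p) ℝ) (v : EuclideanSpace ℝ (Fin p)) :
    ⟪toEuclideanCLM (𝕜 := ℝ) M v, v⟫ = v.ofLp ⬝ᵥ M *ᵥ v.ofLp := by
  rw [real_inner_comm, inner_toEuclideanCLM]

/-- A linear image of a Gaussian vector is standard Gaussian when it whitens the covariance. -/
lemma hasLaw_whitened {S J : Matrix (Fin p) (Fin p) ℝ} (hS : S.PosSemidef) (hJ : J * S * Jᵀ = 1)
    {y : Ω → EuclideanSpace ℝ (Fin p)} (hy : HasLaw y (multivariateGaussian 0 S) P) :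
    HasLaw (fun ω => toEuclideanCLM (𝕜 := ℝ) J (y ω)) (stdGaussian (EuclideanSpace ℝ (Fin p))) P := by
  refine HasLaw.fun_comp (μ := multivariateGaussian 0 S) (X := y)
    (Y := toEuclideanCLM (𝕜 := ℝ) J) ⟨by fun_prop, Measure.ext_of_charFun ?_⟩ hy
  ext u
  rw [charFun_stdGaussian, charFun_apply, integral_map (by fun_prop)
    (Measurable.aestronglyMeasurable (by fun_prop))]
  have h1 : ∀ z : EuclideanSpace ℝ (Fin p), ⟪toEuclideanCLM (𝕜 := ℝ) J z, u⟫ =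
      ⟪z, toEuclideanCLM (𝕜 := ℝ) Jᵀ u⟫ := by
    intro z
    rw [← adjoint_toEuclideanCLM, ContinuousLinearMap.adjoint_inner_right]
  simp only [h1]
  rw [← charFun_apply, charFun_multivariateGaussian hS]
  have h2 : (toEuclideanCLM (𝕜 := ℝ) Jᵀ u).ofLp ⬝ᵥ S *ᵥ (toEuclideanCLM (𝕜 := ℝ) Jᵀ u).ofLp =
      ‖u‖ ^ 2 := by
    rw [ofLp_toEuclideanCLM, EuclideanSpace.real_norm_sq_eq, dotProduct_comm, dotProduct_mulVec,
      vecMul_transpose, mulVec_mulVec, mulVec_mulVec, hJ, one_mulVec]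
    simp [dotProduct, sq]
  rw [h2]
  simp [neg_div]

variable {A Q : Matrix (Fin p) (Fin p) ℝ} {η : ℝ}

lemma IsStationaryCov.eq_add (h : IsStationaryCov η A Q) :
    Q = (1 + η • A) * Q * (1 + η • A)ᵀ + η • (1 : Matrix (Fin p) (Fin p) ℝ) := by
  have h' : A * Q + Q * Aᵀ + η • (A * Q * Aᵀ) + 1 = 0 := h
  have : (1 + η • A) * Q * (1 + η • A)ᵀ + η • (1 : Matrix (Fin p) (Fin p) ℝ) =
      Q + η • (A * Q + Q * Aᵀ + η • (A * Q * Aᵀ) + 1) := by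
    rw [transpose_add, transpose_smul, transpose_one]
    simp only [add_mul, mul_add, one_mul, mul_one, smul_mul_assoc, mul_smul_comm, smul_add]
    abel
  rw [this, h', smul_zero, add_zero]

lemma IsStationaryCov.toEuclideanCLM_eq (h : IsStationaryCov η A Q) :
    toEuclideanCLM (𝕜 := ℝ) Q = toEuclideanCLM (𝕜 := ℝ) (1 + η • A) ∘L toEuclideanCLM (𝕜 := ℝ) Q ∘L
      ContinuousLinearMap.adjoint (toEuclideanCLM (𝕜 := ℝ) (1 + η • A)) +
        η • ContinuousLinearMap.id ℝ (EuclideanSpace ℝ (Fin p)) := by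
  have h1 := congrArg (toEuclideanCLM (n := Fin p) (𝕜 := ℝ)) h.eq_add
  rw [map_add, map_mul, map_mul, map_smul (toEuclideanCLM (n := Fin p) (𝕜 := ℝ)), map_one,
    ← adjoint_toEuclideanCLM] at h1
  exact h1

lemma sigmaMax_lt_one (hη : 0 < η) (hD : 0 < gap η A) : sigmaMax (1 + η • A) < 1 := by
  unfold gap at hD
  have := (div_pos_iff_of_pos_right hη).1 hD
  linarith

lemma IsStationaryCov.posDef (h : IsStationaryCov η A Q) (hη : 0 < η) (hD : 0 < gap η A) :
    Q.PosDef := by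
  have hB := norm_toEuclideanCLM_le_sigmaMax (1 + η • A)
  have hσ := sigmaMax_lt_one hη hD
  refine posDef_iff_dotProduct_mulVec.2 ⟨?_, fun v hv => ?_⟩
  · have := lyapunov_isSymmetric h.toEuclideanCLM_eq hB hσ
    rw [adjoint_toEuclideanCLM] at this
    rw [IsHermitian, conjTranspose_eq_transpose_of_trivial]
    exact (toEuclideanCLM (n := Fin p) (𝕜 := ℝ)).injective this
  · have h1 := lyapunov_lower h.toEuclideanCLM_eq hB hσ hη.le (WithLp.toLp 2 v)
    rw [inner_toEuclideanCLM_self] at h1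
    rw [star_trivial]
    refine lt_of_lt_of_le ?_ h1
    have : WithLp.toLp 2 v ≠ 0 := by simpa using hv
    positivity

lemma exists_whitening {Q : Matrix (Fin p) (Fin p) ℝ} (hQ : Q.PosDef) :
    ∃ R J : Matrix (Fin p) (Fin p) ℝ, Rᵀ = R ∧ R * R = Q ∧ R * J = 1 ∧ J * Q * Jᵀ = 1 := by
  obtain ⟨R, hR, hRR⟩ : ∃ R : Matrix (Fin p) (Fin p) ℝ, Rᵀ = R ∧ R * R = Q := by
    open scoped MatrixOrder in
    exact ⟨CFC.sqrt Q, by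
      have := (CFC.sqrt_nonneg Q).posSemidef.isHermitian
      rwa [IsHermitian, conjTranspose_eq_transpose_of_trivial] at this,
      CFC.sqrt_mul_sqrt_self _ hQ.posSemidef.nonneg⟩
  have hRu : IsUnit R.det := by
    have h1 := (isUnit_iff_isUnit_det _).1 hQ.isUnit
    rw [← hRR, det_mul] at h1
    exact isUnit_of_mul_isUnit_left h1
  refine ⟨R, R⁻¹, hR, hRR, mul_nonsing_inv _ hRu, ?_⟩
  rw [← hRR, transpose_nonsing_inv, hR, ← Matrix.mul_assoc, nonsing_inv_mul _ hRu,
    Matrix.one_mul, mul_nonsing_inv _ hRu]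

/-- The trajectory and the noise of the stationary model are fixed linear functions of a standard
Gaussian vector. -/
theorem IsStationaryModel.exists_representation [IsProbabilityMeasure P] {x w : ℕ → Ω → EuclideanSpace ℝ (Fin p)}
    (h : IsStationaryModel η A Q P x w) (hη : 0 < η) (hD : 0 < gap η A) (n : ℕ) :
    ∃ (L : EuclideanSpace ℝ (Fin p) →L[ℝ] EuclideanSpace ℝ (Fin p))
      (z : Ω → NoiseSpace (EuclideanSpace ℝ (Fin p)) n),
      L ∘L ContinuousLinearMap.adjoint L = toEuclideanCLM (𝕜 := ℝ) Q ∧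
      ContinuousLinearMap.adjoint L ∘L L = toEuclideanCLM (𝕜 := ℝ) Q ∧
      HasLaw z (stdGaussian _) P ∧
      (∀ t ≤ n, ∀ ω, x t ω = stateOp n L (toEuclideanCLM (𝕜 := ℝ) (1 + η • A)) η t (z ω)) ∧
      ∀ t < n, ∀ ω, w (t + 1) ω = √η • coord _ n (t + 1) (z ω) := by
  have hQ := h.cov.posDef hη hD
  obtain ⟨R, R', hR, hRR, hRR', hJQ⟩ := exists_whitening hQ
  have hs : (√η)⁻¹ * (η * (√η)⁻¹) = 1 := by
    have : √η ≠ 0 := (Real.sqrt_pos.2 hη).ne'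
    field_simp
    exact Real.sq_sqrt hη.le |>.symm
  have hJI : ((√η)⁻¹ • (1 : Matrix (Fin p) (Fin p) ℝ)) * (η • 1) *
      ((√η)⁻¹ • (1 : Matrix (Fin p) (Fin p) ℝ))ᵀ = 1 := by
    simp [smul_smul, hs]
  have hηS : (η • (1 : Matrix (Fin p) (Fin p) ℝ)).PosSemidef := PosSemidef.one.smul hη.le
  let J : ℕ → Matrix (Fin p) (Fin p) ℝ := fun t => if t = 0 then R' else (√η)⁻¹ • 1
  -- Slot 0 holds the initial state, since the noise starts at time 1.
  let y : ℕ → Ω → EuclideanSpace ℝ (Fin p) := fun t => if t = 0 then x 0 else w t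
  let v : ℕ → Ω → EuclideanSpace ℝ (Fin p) := fun t ω => toEuclideanCLM (𝕜 := ℝ) (J t) (y t ω)
  have hv : ∀ t, HasLaw (v t) (stdGaussian _) P := by
    intro t
    cases t with
    | zero => exact hasLaw_whitened hQ.posSemidef hJQ h.init_law
    | succ t => exact hasLaw_whitened hηS hJI (h.noise_law t)
  have hgm : ∀ t, Measurable fun u : EuclideanSpace ℝ (Fin p) =>
      toEuclideanCLM (𝕜 := ℝ) (J t) u := fun t => by fun_prop
  have hind : iIndepFun (fun t => v (t + 1)) P :=
    iIndepFun.comp (f := fun t => w (t + 1)) h.noise_indep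
      (fun t (u : EuclideanSpace ℝ (Fin p)) => toEuclideanCLM (𝕜 := ℝ) (J (t + 1)) u)
      fun t => hgm (t + 1)
  have h0 : IndepFun (v 0) (fun ω t => v (t + 1) ω) P :=
    h.init_indep.comp (φ := fun u : EuclideanSpace ℝ (Fin p) => toEuclideanCLM (𝕜 := ℝ) (J 0) u)
      (ψ := fun (u : ℕ → EuclideanSpace ℝ (Fin p)) t => toEuclideanCLM (𝕜 := ℝ) (J (t + 1)) (u t))
      (hgm 0) (measurable_pi_lambda _ fun t => (hgm (t + 1)).comp (measurable_pi_apply t))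
  obtain ⟨z, hzdef⟩ : ∃ z : Ω → NoiseSpace (EuclideanSpace ℝ (Fin p)) n,
      z = fun ω => WithLp.toLp 2 (fun i : Fin (n + 1) => v i ω) := ⟨_, rfl⟩
  have hz : HasLaw z (stdGaussian _) P := hzdef ▸ hasLaw_toLp_stdGaussian hv hind h0 n
  have hcoord : ∀ t ≤ n, ∀ ω, coord (EuclideanSpace ℝ (Fin p)) n t (z ω) = v t ω := by
    intro t ht ω
    rw [coord_apply (Nat.lt_succ_of_le ht), hzdef]
  have hw : ∀ t < n, ∀ ω, w (t + 1) ω =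
      √η • coord (EuclideanSpace ℝ (Fin p)) n (t + 1) (z ω) := by
    intro t ht ω
    have : v (t + 1) ω = (√η)⁻¹ • w (t + 1) ω := by
      simp [v, J, y]
    rw [hcoord _ ht, this, smul_smul, mul_inv_cancel₀ (Real.sqrt_pos.2 hη).ne', one_smul]
  -- L is the symmetric square root of Q, so both products with its adjoint are Q: L L* is the
  -- covariance of x(0), and L* L gives ‖L v‖² = ⟪Q v, v⟫.
  obtain ⟨L, hL⟩ : ∃ L : EuclideanSpace ℝ (Fin p) →L[ℝ] EuclideanSpace ℝ (Fin p),
      L = toEuclideanCLM (𝕜 := ℝ) R := ⟨_, rfl⟩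
  have hLadj : ContinuousLinearMap.adjoint L = L := by rw [hL, adjoint_toEuclideanCLM, hR]
  have hLL : L ∘L L = toEuclideanCLM (𝕜 := ℝ) Q := by
    rw [← hRR, map_mul, hL]; rfl
  refine ⟨L, z, ?_⟩
  refine ⟨by rw [hLadj, hLL], ?_⟩
  refine ⟨by rw [hLadj, hLL], ?_⟩
  refine ⟨hz, ?_⟩
  refine ⟨?_, hw⟩
  intro t ht ω
  induction t with
  | zero =>
    simp only [stateOp, ContinuousLinearMap.comp_apply]
    rw [hcoord 0 (Nat.zero_le n), hL]
    change x 0 ω = (toEuclideanCLM (𝕜 := ℝ) R * toEuclideanCLM (𝕜 := ℝ) R') (x 0 ω)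
    rw [← map_mul, hRR', map_one]
    rfl
  | succ t ih =>
    rw [h.step, hw t (by omega), ih (by omega)]
    simp only [stateOp, _root_.add_apply, ContinuousLinearMap.comp_apply,
      _root_.smul_apply]
    congr 1
    rw [map_add, map_one, map_smul (toEuclideanCLM (n := Fin p) (𝕜 := ℝ))]
    rfl

end Whitening

/-! ### From least squares to the centred lasso objective. -/

section Loss

open Matrix

variable {p : ℕ}

/-- The empirical second moment matrix of a trajectory. -/
def empCov (n : ℕ) (y : ℕ → EuclideanSpace ℝ (Fin p)) : Matrix (Fin p) (Fin p) ℝ :=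
  Matrix.of fun i j => (1 / n) * ∑ t ∈ Finset.range n, y t i * y t j

/-- The negative gradient of the loss at the true row. -/
def noiseCorr (η : ℝ) (n : ℕ) (r : Fin p) (y w : ℕ → EuclideanSpace ℝ (Fin p)) : Fin p → ℝ :=
  fun j => (1 / (n * η)) * ∑ t ∈ Finset.range n, y t j * w (t + 1) r

lemma dotProduct_empCov_mulVec (n : ℕ) (y : ℕ → EuclideanSpace ℝ (Fin p)) (v : Fin p → ℝ) :
    v ⬝ᵥ empCov n y *ᵥ v = (1 / n) * ∑ t ∈ Finset.range n, (∑ j, v j * y t j) ^ 2 := by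
  simp only [dotProduct, mulVec, empCov, of_apply, Finset.mul_sum, Finset.sum_mul, sq]
  have h : ∀ i, ∑ j, ∑ t ∈ Finset.range n, v i * (1 / (n : ℝ) * (y t i * y t j) * v j) =
      ∑ t ∈ Finset.range n, ∑ j, v i * (1 / (n : ℝ) * (y t i * y t j) * v j) :=
    fun i => Finset.sum_comm
  simp only [h]
  rw [Finset.sum_comm]
  refine Finset.sum_congr rfl fun t _ => Finset.sum_congr rfl fun i _ =>
    Finset.sum_congr rfl fun j _ => ?_
  ring

lemma noiseCorr_dotProduct (η : ℝ) (n : ℕ) (r : Fin p) (y w : ℕ → EuclideanSpace ℝ (Fin p))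
    (v : Fin p → ℝ) : noiseCorr η n r y w ⬝ᵥ v =
      (1 / (n * η)) * ∑ t ∈ Finset.range n, w (t + 1) r * ∑ j, v j * y t j := by
  simp only [dotProduct, noiseCorr, Finset.mul_sum, Finset.sum_mul]
  rw [Finset.sum_comm]
  refine Finset.sum_congr rfl fun t _ => Finset.sum_congr rfl fun j _ => ?_
  ring

variable {A : Matrix (Fin p) (Fin p) ℝ} {η : ℝ} {n : ℕ} {y w : ℕ → EuclideanSpace ℝ (Fin p)}

/-- The residual at b is w_r(t+1) - η⟨b - A_r, y(t)⟩. Expanding its square leaves a term free of b,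
so both problems have the same minimisers. -/
lemma lossL_add_eq_lassoObj (hη : η ≠ 0) (hn : n ≠ 0)
    (hstep : ∀ t, y (t + 1) = y t + η • toEuclideanLin A (y t) + w (t + 1)) (r : Fin p)
    (lam : ℝ) (b : Fin p → ℝ) :
    lossL η n r y b + lam * ∑ j, |b j| =
      lassoObj (empCov n y) (noiseCorr η n r y w) (A r) lam b +
        1 / (2 * η ^ 2 * n) * ∑ t ∈ Finset.range n, w (t + 1) r ^ 2 := by
  have hres : ∀ t, y (t + 1) r - y t r - η * ∑ j, b j * y t j =
      w (t + 1) r - η * ∑ j, (b - A r) j * y t j := by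
    intro t
    have h1 : (toEuclideanLin A (y t)) r = ∑ j, A r j * y t j := rfl
    rw [hstep]
    simp only [PiLp.add_apply, PiLp.smul_apply, h1, smul_eq_mul, Pi.sub_apply, sub_mul,
      Finset.sum_sub_distrib]
    ring
  have hn' : (n : ℝ) ≠ 0 := Nat.cast_ne_zero.2 hn
  unfold lossL lassoObj
  simp only [hres]
  rw [dotProduct_empCov_mulVec, noiseCorr_dotProduct]
  have hexp : ∑ t ∈ Finset.range n, (w (t + 1) r - η * ∑ j, (b - A r) j * y t j) ^ 2 =
      ∑ t ∈ Finset.range n, w (t + 1) r ^ 2 -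
        2 * η * ∑ t ∈ Finset.range n, w (t + 1) r * ∑ j, (b - A r) j * y t j +
        η ^ 2 * ∑ t ∈ Finset.range n, (∑ j, (b - A r) j * y t j) ^ 2 := by
    rw [Finset.mul_sum, Finset.mul_sum, ← Finset.sum_sub_distrib, ← Finset.sum_add_distrib]
    exact Finset.sum_congr rfl fun t _ => by ring
  rw [hexp]
  field_simp
  ring

/-- Deterministic recovery guarantee along a trajectory. -/
theorem recoversSignedSupport_of_close {Q : Matrix (Fin p) (Fin p) ℝ} (hη : 0 < η) (hn : n ≠ 0)
    (hstep : ∀ t, y (t + 1) = y t + η • toEuclideanLin A (y t) + w (t + 1)) (r : Fin p)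
    (hQ : Q.IsHermitian) {lam e k : ℝ} (hlam : 0 < lam) (hC : 0 < Cmin A Q r)
    (hα : 0 < incoherence A Q r) (hk : ((rowSupport A r).card : ℝ) ≤ k) (he : 0 ≤ e)
    (hek : e * k ≤ incoherence A Q r * Cmin A Q r / 12)
    (hclose : ∀ i, ∀ j ∈ rowSupport A r, |empCov n y i j - Q i j| ≤ e)
    (hg : ∀ j, |noiseCorr η n r y w j| ≤ lam * incoherence A Q r / 3)
    (hmin : 16 * k * lam / (11 * Cmin A Q r) < Amin A r) :
    RecoversSignedSupport η n lam A r y := by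
  have hiff : ∀ a, IsRegLeastSquares η n lam r y a ↔
      ∀ b, lassoObj (empCov n y) (noiseCorr η n r y w) (A r) lam a ≤
        lassoObj (empCov n y) (noiseCorr η n r y w) (A r) lam b := by
    intro a
    simp only [IsRegLeastSquares, lossL_add_eq_lassoObj hη.ne' hn hstep, add_le_add_iff_right]
  unfold RecoversSignedSupport
  simp only [hiff]
  refine lasso_recovery (S := rowSupport A r) (Q := Q) ?_ (fun v => ?_) (fun j => ?_) hlam hC hα
    (incoherence_le_one A Q r) hk he hek (fun v => ?_)
    (fun i hi => exists_incoherent_row hC i hi) hclose hg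
    (fun j hj => hmin.trans_le (Amin_le hj))
  · ext i j
    simp only [transpose_apply, empCov, of_apply, mul_comm]
  · rw [dotProduct_empCov_mulVec]
    exact mul_nonneg (by positivity) (Finset.sum_nonneg fun t _ => sq_nonneg _)
  · simp [rowSupport]
  · exact lambdaMin_mul_le (M := block Q (rowSupport A r) (rowSupport A r))
      (hQ.submatrix _) v

end Loss

/-! ### Tail bounds transferred to the model. -/

section Probability

open Matrix

variable {p : ℕ} {A Q : Matrix (Fin p) (Fin p) ℝ} {η : ℝ} {Ω : Type*} [MeasurableSpace Ω]
  {P : Measure Ω} [IsProbabilityMeasure P] {x w : ℕ → Ω → EuclideanSpace ℝ (Fin p)}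

lemma one_sub_sigmaMax (hη : 0 < η) : 1 - sigmaMax (1 + η • A) = η * gap η A := by
  unfold gap; field_simp

lemma IsStationaryCov.norm_factor_sq_le (h : IsStationaryCov η A Q) (hη : 0 < η)
    (hD : 0 < gap η A) {L : EuclideanSpace ℝ (Fin p) →L[ℝ] EuclideanSpace ℝ (Fin p)}
    (hL : ContinuousLinearMap.adjoint L ∘L L = toEuclideanCLM (𝕜 := ℝ) Q)
    (v : EuclideanSpace ℝ (Fin p)) :
    ‖L v‖ ^ 2 ≤ η / (1 - sigmaMax (1 + η • A)) * ‖v‖ ^ 2 := by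
  refine le_trans (le_of_eq ?_) (lyapunov_upper h.toEuclideanCLM_eq
    (norm_toEuclideanCLM_le_sigmaMax _) (sigmaMax_lt_one hη hD) hη.le v)
  rw [← hL, ContinuousLinearMap.comp_apply, ContinuousLinearMap.adjoint_inner_left,
    real_inner_self_eq_norm_sq]

lemma toEuclideanCLM_single_apply (M : Matrix (Fin p) (Fin p) ℝ) (i j : Fin p) :
    toEuclideanCLM (𝕜 := ℝ) M (EuclideanSpace.single j 1) i = M i j := by
  rw [ofLp_toEuclideanCLM]; simp

lemma IsStationaryCov.diag_le (h : IsStationaryCov η A Q) (hη : 0 < η) (hD : 0 < gap η A)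
    (j : Fin p) : Q j j ≤ 1 / gap η A := by
  have := lyapunov_upper h.toEuclideanCLM_eq (norm_toEuclideanCLM_le_sigmaMax _)
    (sigmaMax_lt_one hη hD) hη.le (EuclideanSpace.single j 1)
  rw [EuclideanSpace.inner_single_right, toEuclideanCLM_single_apply, one_sub_sigmaMax hη,
    div_mul_cancel_left₀ hη.ne'] at this
  simpa using this

theorem IsStationaryModel.noiseCorr_tail (h : IsStationaryModel η A Q P x w) (hη : 0 < η)
    (hD : 0 < gap η A) {n : ℕ} (hn : 0 < n) (r j : Fin p) {ε : ℝ} (hε : 0 ≤ ε)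
    (hε2 : ε ≤ 1 / 2) :
    P.real {ω | ε ≤ |noiseCorr η n r (fun t => x t ω) (fun t => w t ω) j|} ≤
      2 * Real.exp (-(n * η * gap η A * ε ^ 2 / 4)) := by
  obtain ⟨L, z, hL, hL', hz, hx, hw⟩ := h.exists_representation hη hD n
  have hn' : (0 : ℝ) < n := Nat.cast_pos.2 hn
  have ht := gradient_tail hL h.cov.toEuclideanCLM_eq (norm_toEuclideanCLM_le_sigmaMax _)
    (sigmaMax_lt_one hη hD) hη (IsStationaryCov.norm_factor_sq_le h.cov hη hD hL') hn r j hε hε2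
  rw [one_sub_sigmaMax hη, show n * η * (η * gap η A) / η * ε ^ 2 / 4 =
    n * η * gap η A * ε ^ 2 / 4 by field_simp] at ht
  rw [← hz.measureReal_eq (measurableSet_le (by fun_prop) (by fun_prop))] at ht
  refine le_trans (le_of_eq ?_) ht
  congr 1
  ext ω
  have hs : ∑ t ∈ Finset.range n, x t ω j * w (t + 1) ω r =
      ∑ t ∈ Finset.range n, ⟪stateVec n L (toEuclideanCLM (𝕜 := ℝ) (1 + η • A)) η j t, z ω⟫ *
        ⟪noiseVec n η r (t + 1), z ω⟫ := by
    refine Finset.sum_congr rfl fun t ht => ?_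
    have htn := Finset.mem_range.1 ht
    rw [inner_stateVec, inner_noiseVec, ← hx t htn.le ω, hw t htn ω]
    simp
  simp only [Set.mem_ofPred_eq, noiseCorr, hs]
  rw [abs_mul, abs_of_pos (by positivity), one_div, ← div_eq_inv_mul, le_div_iff₀ (by positivity),
    mul_comm ε]

theorem IsStationaryModel.empCov_tail (h : IsStationaryModel η A Q P x w) (hη : 0 < η)
    (hD : 0 < gap η A) {n : ℕ} (hn : 0 < n) (i j : Fin p) {ε : ℝ} (hε : 0 ≤ ε)
    (hε2 : ε ≤ 1 / gap η A) :
    P.real {ω | ε ≤ |empCov n (fun t => x t ω) i j - Q i j|} ≤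
      2 * Real.exp (-(n * η * gap η A ^ 3 * ε ^ 2 / 8)) := by
  obtain ⟨L, z, hL, hL', hz, hx, hw⟩ := h.exists_representation hη hD n
  have hn' : (0 : ℝ) < n := Nat.cast_pos.2 hn
  have ht := covariance_tail hL h.cov.toEuclideanCLM_eq (norm_toEuclideanCLM_le_sigmaMax _)
    (sigmaMax_lt_one hη hD) hη (IsStationaryCov.norm_factor_sq_le h.cov hη hD hL') hn i j hε
    (by rwa [one_sub_sigmaMax hη, div_mul_cancel_left₀ hη.ne', ← one_div])
  rw [one_sub_sigmaMax hη, mul_div_cancel_left₀ _ hη.ne', toEuclideanCLM_single_apply] at ht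
  rw [← hz.measureReal_eq (measurableSet_le (by fun_prop) (by fun_prop))] at ht
  refine le_trans (le_of_eq ?_) ht
  congr 1
  ext ω
  have hs : ∑ t ∈ Finset.range n, x t ω i * x t ω j =
      ∑ t ∈ Finset.range n, ⟪stateVec n L (toEuclideanCLM (𝕜 := ℝ) (1 + η • A)) η i t, z ω⟫ *
        ⟪stateVec n L (toEuclideanCLM (𝕜 := ℝ) (1 + η • A)) η j t, z ω⟫ := by
    refine Finset.sum_congr rfl fun t ht => ?_
    have htn := Finset.mem_range.1 ht
    rw [inner_stateVec, inner_stateVec, ← hx t htn.le ω]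
  simp only [Set.mem_ofPred_eq, empCov, of_apply, hs]
  rw [show ∀ s : ℝ, 1 / (n : ℝ) * s - Q i j = (n : ℝ)⁻¹ * (s - n * Q i j) from fun s => by
    field_simp, abs_mul, abs_of_pos (by positivity), ← div_eq_inv_mul,
    le_div_iff₀ (by positivity), mul_comm ε]

/-- A Rayleigh quotient at a basis vector gives C ≤ Q j j ≤ 1/D. This puts the deviation e in the
admissible range of the covariance tail. -/
lemma Cmin_le (h : IsStationaryCov η A Q) (hη : 0 < η) (hD : 0 < gap η A) {r : Fin p}
    (hC : 0 < Cmin A Q r) : Cmin A Q r ≤ 1 / gap η A := by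
  obtain ⟨j, hj⟩ := rowSupport_nonempty hC
  have hQ := (h.posDef hη hD).isHermitian
  have h1 := lambdaMin_mul_le (M := block Q (rowSupport A r) (rowSupport A r))
    (hQ.submatrix _) (Pi.single ⟨j, hj⟩ 1)
  refine le_trans ?_ (h.diag_le hη hD j)
  simpa [Pi.single_apply, block, Cmin] using h1

end Probability

/-! ### Numerical constants and the final union bound. -/

/-- Consequences of the sample size condition. -/
lemma sample_size_bounds {k D α C a ℓ T : ℝ} (hk : 1 ≤ k) (hD : 0 < D) (hα : 0 < α) (hα1 : α ≤ 1)
    (hC : 0 < C) (hCD : C ≤ 1 / D) (ha : 0 < a) (hℓ : 0 < ℓ)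
    (hT : 10 ^ 4 * k ^ 2 * (k * D ^ (-2 : ℤ) + a ^ (-2 : ℤ)) / (α ^ 2 * D * C ^ 2) * ℓ < T) :
    0 < T ∧ 16 * ℓ ≤ D * T ∧ ℓ < T * D ^ 3 * (α * C / (12 * k)) ^ 2 / 8 ∧
      36 * ℓ / (D * α ^ 2 * T) < (11 * a * C / (16 * k)) ^ 2 := by
  have hk0 : 0 < k := by linarith
  have hD2 : D ^ (-2 : ℤ) = (D ^ 2)⁻¹ := by rw [zpow_neg]; rfl
  have ha2 : a ^ (-2 : ℤ) = (a ^ 2)⁻¹ := by rw [zpow_neg]; rfl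
  rw [hD2, ha2] at hT
  -- Each summand of kD⁻² + a⁻² is used alone: the first for the concentration bounds, the second
  -- for the smallest nonzero entry.
  have h1 : 10 ^ 4 * k ^ 2 * (k * (D ^ 2)⁻¹) / (α ^ 2 * D * C ^ 2) * ℓ < T := by
    refine lt_of_le_of_lt ?_ hT
    gcongr
    exact le_add_of_nonneg_right (by positivity)
  have h2 : 10 ^ 4 * k ^ 2 * (a ^ 2)⁻¹ / (α ^ 2 * D * C ^ 2) * ℓ < T := by
    refine lt_of_le_of_lt ?_ hT
    gcongr
    exact le_add_of_nonneg_left (by positivity)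
  have hT0 : 0 < T := lt_of_le_of_lt (by positivity) h1
  have h1' : 10 ^ 4 * k ^ 3 * ℓ < T * (D ^ 3 * α ^ 2 * C ^ 2) := by
    rw [← div_lt_iff₀ (by positivity)]
    refine lt_of_eq_of_lt ?_ h1
    field_simp
  have h2' : 10 ^ 4 * k ^ 2 * ℓ < T * (D * α ^ 2 * C ^ 2 * a ^ 2) := by
    rw [← div_lt_iff₀ (by positivity)]
    refine lt_of_eq_of_lt ?_ h2
    field_simp
  have hCD' : C * D ≤ 1 := by rwa [le_div_iff₀ hD] at hCD
  have hαCD : (α * (C * D)) ^ 2 ≤ 1 :=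
    pow_le_one₀ (by positivity) (mul_le_one₀ hα1 (by positivity) hCD')
  refine ⟨hT0, ?_, ?_, ?_⟩
  · have h3 : T * (D ^ 3 * α ^ 2 * C ^ 2) ≤ D * T := by
      calc T * (D ^ 3 * α ^ 2 * C ^ 2) = (D * T) * (α * (C * D)) ^ 2 := by ring
        _ ≤ (D * T) * 1 := by gcongr
        _ = _ := mul_one _
    have h4 : 16 * ℓ ≤ 10 ^ 4 * k ^ 3 * ℓ := by
      have : 1 ≤ k ^ 3 := one_le_pow₀ hk
      gcongr; linarith
    linarith
  · have h3 : T * D ^ 3 * (α * C / (12 * k)) ^ 2 / 8 =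
        T * (D ^ 3 * α ^ 2 * C ^ 2) / (1152 * k ^ 2) := by field_simp; ring
    rw [h3, lt_div_iff₀ (by positivity)]
    refine lt_of_le_of_lt ?_ h1'
    have : k ^ 2 * ℓ ≤ k ^ 3 * ℓ := by gcongr; linarith
    have h0 : 0 ≤ k ^ 3 * ℓ := by positivity
    linarith
  · rw [div_lt_iff₀ (by positivity)]
    have h3 : (11 * a * C / (16 * k)) ^ 2 * (D * α ^ 2 * T) =
        121 / 256 * (T * (D * α ^ 2 * C ^ 2 * a ^ 2)) / k ^ 2 := by field_simp; norm_num
    rw [h3, lt_div_iff₀ (by positivity)]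
    have h0 : 0 < k ^ 2 * ℓ := by positivity
    linarith

/-- The bad set need not be measurable, so the event is the complement of its measurable hull, which
has the same measure. -/
lemma exists_measurableSet_of_bad {Ω : Type*} [MeasurableSpace Ω] {P : Measure Ω}
    [IsProbabilityMeasure P] {δ : ℝ} {bad : Set Ω} (h : P.real bad < δ) {good : Ω → Prop}
    (hgood : ∀ ω, ω ∉ bad → good ω) :
    ∃ E : Set Ω, MeasurableSet E ∧ (∀ ω ∈ E, good ω) ∧ 1 - δ < P.real E := by
  refine ⟨(toMeasurable P bad)ᶜ, (measurableSet_toMeasurable P bad).compl,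
    fun ω hω => hgood ω fun hb => hω (subset_toMeasurable P bad hb), ?_⟩
  rw [probReal_compl_eq_one_sub (measurableSet_toMeasurable P bad), measureReal_def,
    measure_toMeasurable, ← measureReal_def]
  linarith

end NetLearn

end

/-- "With probability larger than `1 - δ`" is stated through a measurable event `E` on which
recovery takes place. -/
theorem theorem3 {p : ℕ} (A Q : Matrix (Fin p) (Fin p) ℝ) (r : Fin p) (k n : ℕ) (η δ : ℝ)
    {Ω : Type*} [MeasurableSpace Ω] (P : Measure Ω) [IsProbabilityMeasure P]
    (x w : ℕ → Ω → EuclideanSpace ℝ (Fin p))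
    (hη : 0 < η) (hδ : 0 < δ)
    (hmodel : NetLearn.IsStationaryModel η A Q P x w)
    (hk : (NetLearn.rowSupport A r).card ≤ k)
    (hC : 0 < NetLearn.Cmin A Q r)
    (hα : 0 < NetLearn.incoherence A Q r)
    (hD : 0 < NetLearn.gap η A)
    (hn : 10 ^ 4 * (k : ℝ) ^ 2 *
          (k * NetLearn.gap η A ^ (-2 : ℤ) + NetLearn.Amin A r ^ (-2 : ℤ)) /
          (NetLearn.incoherence A Q r ^ 2 * NetLearn.gap η A * NetLearn.Cmin A Q r ^ 2) *
          Real.log (4 * p * k / δ) < n * η) :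
    ∃ E : Set Ω, MeasurableSet E ∧
      (∀ ω ∈ E, NetLearn.RecoversSignedSupport η n (NetLearn.regParam η n δ A Q r) A r
        (fun t => x t ω)) ∧
      1 - δ < P.real E := by
  -- For δ > 1 the empty event suffices; otherwise log(4p/δ) is positive.
  rcases lt_or_ge 1 δ with hδ1 | hδ1
  · exact ⟨∅, MeasurableSet.empty, by simp, by simpa using hδ1⟩
  have hSne := NetLearn.rowSupport_nonempty hC
  have hk1 : (1 : ℝ) ≤ k := by exact_mod_cast (Finset.card_pos.2 hSne).trans_le hk
  have hp1 : (1 : ℝ) ≤ p := by exact_mod_cast Fin.pos r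
  have hp0 : (0 : ℝ) < p := by linarith
  have hk0 : (0 : ℝ) < k := by linarith
  set D := NetLearn.gap η A with hDdef
  set α := NetLearn.incoherence A Q r with hαdef
  set C := NetLearn.Cmin A Q r with hCdef
  set a := NetLearn.Amin A r
  have hα1 : α ≤ 1 := NetLearn.incoherence_le_one A Q r
  have hCD : C ≤ 1 / D := NetLearn.Cmin_le hmodel.cov hη hD hC
  have hle : 4 * p / δ ≤ 4 * p * k / δ :=
    div_le_div_of_nonneg_right (le_mul_of_one_le_right (by positivity) hk1) hδ.le
  have h4 : 1 < 4 * p / δ := by rw [one_lt_div hδ]; linarith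
  set ℓ' := Real.log (4 * p / δ)
  set ℓ := Real.log (4 * p * k / δ)
  have hℓ'0 : 0 < ℓ' := Real.log_pos h4
  have hℓℓ : ℓ' ≤ ℓ := Real.log_le_log (by linarith) hle
  obtain ⟨hT, hDT, hcov, hlam⟩ := NetLearn.sample_size_bounds hk1 hD hα hα1 hC hCD
    (NetLearn.Amin_pos hSne) (hℓ'0.trans_le hℓℓ) hn
  have hn0 : 0 < n := by
    rcases Nat.eq_zero_or_pos n with h | h
    · simp [h] at hT
    · exact h
  set lam := NetLearn.regParam η n δ A Q r
  have hlamsq : lam ^ 2 = 36 * ℓ' / (D * α ^ 2 * (n * η)) :=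
    Real.sq_sqrt (by positivity)
  have hlam0 : 0 < lam := Real.sqrt_pos.2 (by positivity)
  -- The two thresholds of the deterministic theorem. The 36 in λ makes nηDε²/4 equal to log(4p/δ),
  -- so each gradient entry fails with probability at most δ/(2p).
  set ε := lam * α / 3 with hε
  set e := α * C / (12 * k) with he
  have hε0 : 0 < ε := by positivity
  have he0 : 0 < e := by positivity
  have hεsq : ε ^ 2 = 4 * ℓ' / (D * (n * η)) := by
    rw [hε, div_pow, mul_pow, hlamsq]
    field_simp
    norm_num
  have hε2 : ε ≤ 1 / 2 := by
    refine abs_le_of_sq_le_sq' ?_ (by norm_num) |>.2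
    rw [hεsq, div_le_iff₀ (by positivity)]
    linarith
  have he2 : e ≤ 1 / D := by
    refine le_trans ?_ hCD
    rw [he, div_le_iff₀ (by positivity)]
    nlinarith
  let S := NetLearn.rowSupport A r
  let badG : Fin p → Set Ω := fun j =>
    {ω | ε ≤ |NetLearn.noiseCorr η n r (fun t => x t ω) (fun t => w t ω) j|}
  let badQ : Fin p → Fin p → Set Ω := fun i j =>
    {ω | e ≤ |NetLearn.empCov n (fun t => x t ω) i j - Q i j|}
  have hG : ∀ j, P.real (badG j) ≤ δ / (2 * p) := by
    intro j
    refine (hmodel.noiseCorr_tail hη hD hn0 r j hε0.le hε2).trans (le_of_eq ?_)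
    have : n * η * NetLearn.gap η A * ε ^ 2 / 4 = ℓ' := by
      rw [hεsq, ← hDdef]; field_simp
    rw [this, Real.exp_neg, Real.exp_log (by linarith)]
    field_simp
    norm_num
  -- Strictness in the sample size condition is what makes the final probability strictly larger
  -- than 1 - δ; the gradient family only gives ≤.
  have hQ : ∀ i j, P.real (badQ i j) < δ / (2 * p * k) := by
    intro i j
    refine (hmodel.empCov_tail hη hD hn0 i j he0.le he2).trans_lt ?_
    have h1 : Real.exp (-(n * η * NetLearn.gap η A ^ 3 * e ^ 2 / 8)) < Real.exp (-ℓ) :=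
      Real.exp_lt_exp.2 (neg_lt_neg hcov)
    have h2 : Real.exp (-ℓ) = δ / (4 * p * k) := by
      rw [Real.exp_neg, Real.exp_log (by positivity), inv_div]
    have h3 : δ / (2 * p * k) = 2 * (δ / (4 * p * k)) := by field_simp; norm_num
    rw [h3, ← h2]
    linarith
  refine NetLearn.exists_measurableSet_of_bad
    (bad := (⋃ j, badG j) ∪ ⋃ i, ⋃ j ∈ S, badQ i j) ?_ fun ω hω => ?_
  · have hbG : P.real (⋃ j, badG j) ≤ δ / 2 := by
      refine (measureReal_iUnion_fintype_le _).trans ?_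
      refine (Finset.sum_le_sum fun j _ => hG j).trans (le_of_eq ?_)
      simp
      field_simp
    have hbQ : P.real (⋃ i, ⋃ j ∈ S, badQ i j) < δ / 2 := by
      refine (measureReal_iUnion_fintype_le _).trans_lt ?_
      have hi : ∀ i, P.real (⋃ j ∈ S, badQ i j) < δ / (2 * p) := by
        intro i
        refine (measureReal_biUnion_finset_le S _).trans_lt ?_
        refine (Finset.sum_lt_sum_of_nonempty hSne fun j _ => hQ i j).trans_le ?_
        rw [Finset.sum_const, nsmul_eq_mul]
        calc (S.card : ℝ) * (δ / (2 * p * k)) ≤ k * (δ / (2 * p * k)) := by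
              gcongr
          _ = _ := by field_simp
      refine (Finset.sum_lt_sum_of_nonempty ⟨r, Finset.mem_univ r⟩ fun i _ => hi i).trans_le
        (le_of_eq ?_)
      simp
      field_simp
    have := measureReal_union_le (μ := P) (⋃ j, badG j) (⋃ i, ⋃ j ∈ S, badQ i j)
    linarith
  · simp only [Set.mem_union, Set.mem_iUnion, not_or, not_exists] at hω
    refine NetLearn.recoversSignedSupport_of_close (Q := Q) (e := e) (k := k)
      (w := fun t => w t ω) hη hn0.ne' (fun t => hmodel.step t ω) r
      (hmodel.cov.posDef hη hD).isHermitian hlam0 hC hα (by exact_mod_cast hk) he0.le ?_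
      (fun i j hj => (not_le.1 (hω.2 i j hj)).le) (fun j => (not_le.1 (hω.1 j)).le) ?_
    · rw [he, ← hαdef, ← hCdef]
      apply le_of_eq
      field_simp
    · have h1 : lam < 11 * a * C / (16 * k) := by
        have ha0 : 0 < a := NetLearn.Amin_pos hSne
        refine lt_of_pow_lt_pow_left₀ 2 (by positivity) ?_
        rw [hlamsq]
        refine lt_of_le_of_lt ?_ hlam
        gcongr
      rw [lt_div_iff₀ (by positivity)] at h1
      rw [div_lt_iff₀ (by positivity)]
      linarith
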